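/- Let $l\ge 1$ be an integer. Let $B_{X1},B_{X2},\dots$ and $B_{Y1},B_{Y2},\dots$ be two i.i.d. sequences, independent of each other, whose terms are uniformly distributed on $\{l-1,l,l+1\}$. Let $X^\infty=X_1X_2X_3\dots$ be the infinite binary sequence whose first symbol $X_1$ is $0$ or $1$ with probability $1/2$ each, independently of the block lengths, and whose $i$-th block has length $B_{Xi}$ for every $i\ge1$, where consecutive blocks consist alternately of $0$'s and of $1$'s. Let $Y^\infty=Y_1Y_2Y_3\dots$ be constructed in the same way from $B_{Y1},B_{Y2},\dots$ and a fair first symbol $Y_1$, so that $X^\infty$ and $Y^\infty$ are independent. For $n\ge 1$ let $L_n$ be the length of the longest common subsequences of the strings $X_1X_2\dots X_n$ and $Y_1Y_2\dots Y_n$. **Theorem.** There exists $l_0$ such that for all $l\ge l_0$ we have $\mathrm{VAR}[L_n]=\Theta(n)$ for $n$ large enough; that is, for every $l\ge l_0$ there are constants $0<a<b$ and an integer $n_0$, which may depend on $l$ but not on $n$, such that $$a\,n\le \mathrm{VAR}[L_n]\le b\,n\qquad\text{for all } n\ge n_0 .$$ -/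

import Mathlib

open MeasureTheory ProbabilityTheory

namespace BlockLCS

/-- The length of the longest common subsequences of two strings. The set is nonempty (it contains
the length `0` of the empty string) and bounded by `x.length`, so the supremum is a maximum. -/
noncomputable def lcsLength {α : Type*} (x y : List α) : ℕ :=
  sSup {k : ℕ | ∃ z : List α, z.Sublist x ∧ z.Sublist y ∧ z.length = k}

/-- For consecutive blocks of lengths `b 0, b 1, b 2, …`, the index of the block that contains the
position `t` (blocks and positions are numbered from `0`): the least `k` such that the blocks
`0, …, k` together cover more than `t` positions. -/
noncomputable def blockIndex (b : ℕ → ℕ) (t : ℕ) : ℕ :=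
  sInf {k : ℕ | t < ∑ i ∈ Finset.range (k + 1), b i}

/-- The infinite binary sequence (`false` is the symbol 0, `true` is the symbol 1) whose first
block consists of the symbol `c`, whose symbol changes from each block to the next one, and whose
`i`-th block has length `b i`. -/
noncomputable def blockSeq (c : Bool) (b : ℕ → ℕ) (t : ℕ) : Bool :=
  if Even (blockIndex b t) then c else !c

/-- The string of the first `n` symbols of `blockSeq c b`. -/
noncomputable def blockString (c : Bool) (b : ℕ → ℕ) (n : ℕ) : List Bool :=
  (List.range n).map (blockSeq c b)

/-- The data of one random sequence of the block model with parameter `l`: the first symbol `c` is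
a fair bit, the block lengths `B 0, B 1, …` are i.i.d. and uniform on `{l - 1, l, l + 1}`, and the
first symbol is independent of the block lengths. -/
structure IsBlockData {Ω : Type*} [MeasurableSpace Ω] (μ : Measure Ω) (l : ℕ)
    (c : Ω → Bool) (B : ℕ → Ω → ℕ) : Prop where
  measurable_symbol : Measurable c
  measurable_length : ∀ i, Measurable (B i)
  symbol_law : ∀ s : Bool, μ {ω | c ω = s} = 1 / 2
  length_law_pred : ∀ i, μ {ω | B i ω + 1 = l} = 1 / 3
  length_law_self : ∀ i, μ {ω | B i ω = l} = 1 / 3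
  length_law_succ : ∀ i, μ {ω | B i ω = l + 1} = 1 / 3
  indep_length : iIndepFun B μ
  indep_symbol_length : IndepFun c (fun ω i => B i ω) μ

/-- The block model with parameter `l`: two families of block data that are independent of each
other, for the first sequence `X` and the second sequence `Y`. -/
structure IsBlockModel {Ω : Type*} [MeasurableSpace Ω] (μ : Measure Ω) (l : ℕ)
    (cX : Ω → Bool) (BX : ℕ → Ω → ℕ) (cY : Ω → Bool) (BY : ℕ → Ω → ℕ) : Prop where
  left : IsBlockData μ l cX BX
  right : IsBlockData μ l cY BY
  indep : IndepFun (fun ω => (cX ω, fun i => BX i ω)) (fun ω => (cY ω, fun i => BY i ω)) μ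

/-- The length `L_n` of the longest common subsequences of the first `n` symbols of the two random
sequences with first symbols `cX`, `cY` and block lengths `BX`, `BY`. -/
noncomputable def L {Ω : Type*} (cX : Ω → Bool) (BX : ℕ → Ω → ℕ) (cY : Ω → Bool) (BY : ℕ → Ω → ℕ)
    (n : ℕ) (ω : Ω) : ℕ :=
  lcsLength (blockString (cX ω) (fun i => BX i ω) n) (blockString (cY ω) (fun i => BY i ω) n)

end BlockLCS

/-! Both bounds are proved in a finite uniform model: up to null sets, $L_n$ depends only on the two
first symbols and on finitely many offsets in `Fin 3`, where offset $v$ means block length $l-1+v$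
(`IsBlockModel.variance_eq`). A common subsequence is treated as a monotone list of pairs of equally
coloured blocks that respects the block capacities (`IsAlignment`).

Upper bound: changing one block length by at most 2 changes the LCS by at most 2, so Efron–Stein
(`uvar_pi_le`) gives a linear bound for fixed first symbols. Changing the first symbols moves the
mean by at most $l+1$ (`avg_lcsModel_le`), which adds a constant.

Lower bound: the blocks of $X$ are grouped in neighbouring pairs. Replacing the offsets $(0,2)$ or
$(2,0)$ of a pair by $(1,1)$ moves one symbol across a block boundary and leaves every other block
in place. If the total expected increment of the LCS under these replacements is at least $cM$,
where the $M$ pairs lie within the first $n$ symbols, then the covariance of the LCS with a centred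
sum $S$ of independent terms is at least $cM$. Since the variance of $S$ is of order $n$,
Cauchy–Schwarz (`sq_avg_increment_le`) gives a linear lower bound.

To bound the increment: for large $l$ almost every block is matched with exactly one block, which it
shares with no other (`exists_isolated`). When a short block is lengthened, one symbol is gained if
its partner has offset at least 1 (probability $2/3$ for a fixed partner). When a long block is
shortened, at most one symbol is lost, and only if its partner has offset 2 (probability $1/3$).
Hence the mean gain for a fixed matching is positive. The true matching depends on the randomness,
but it is determined by the two small sets of unmatched blocks (`exists_partner`). An
exponential-moment union bound over all such codes (`sum_codes_le`, `le_avg_score`) shows that the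
gain stays linear, up to a charge of 10 per unmatched block. For $l>10^6$ this charge is negligible.
-/

namespace BlockLCS

/-! ### Block positions and capacities -/

/-- The position at which block `k` starts. -/
def blockStart (b : ℕ → ℕ) (k : ℕ) : ℕ := ∑ i ∈ Finset.range k, b i

lemma blockStart_succ (b : ℕ → ℕ) (k : ℕ) : blockStart b (k + 1) = blockStart b k + b k :=
  Finset.sum_range_succ _ _

lemma blockStart_mono (b : ℕ → ℕ) : Monotone (blockStart b) :=
  monotone_nat_of_le_succ fun k => by rw [blockStart_succ]; omega

lemma le_blockStart {b : ℕ → ℕ} (hb : ∀ i, 1 ≤ b i) (k : ℕ) : k ≤ blockStart b k := by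
  induction k with
  | zero => simp
  | succ k ih => rw [blockStart_succ]; have := hb k; omega

lemma blockIndex_spec {b : ℕ → ℕ} (hb : ∀ i, 1 ≤ b i) (t : ℕ) :
    blockStart b (blockIndex b t) ≤ t ∧ t < blockStart b (blockIndex b t + 1) := by
  have hne : {k : ℕ | t < ∑ i ∈ Finset.range (k + 1), b i}.Nonempty :=
    ⟨t, lt_of_lt_of_le (Nat.lt_succ_self t) (le_blockStart hb (t + 1))⟩
  refine ⟨?_, Nat.sInf_mem hne⟩
  by_contra! h
  rcases Nat.eq_zero_or_pos (blockIndex b t) with h0 | h0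
  · rw [h0] at h; simp [blockStart] at h
  · have : blockIndex b t - 1 ∈ {k : ℕ | t < ∑ i ∈ Finset.range (k + 1), b i} := by
      have e : blockIndex b t - 1 + 1 = blockIndex b t := by omega
      simp only [Set.mem_ofPred_eq, e]
      exact h
    have h2 : blockIndex b t ≤ blockIndex b t - 1 := Nat.sInf_le this
    omega

lemma blockIndex_eq_iff {b : ℕ → ℕ} (hb : ∀ i, 1 ≤ b i) (t i : ℕ) :
    blockIndex b t = i ↔ blockStart b i ≤ t ∧ t < blockStart b (i + 1) := by
  have hs := blockIndex_spec hb t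
  constructor
  · rintro rfl; exact hs
  · rintro ⟨h1, h2⟩
    by_contra hne
    rcases lt_or_gt_of_ne hne with h | h
    · have := blockStart_mono b (show blockIndex b t + 1 ≤ i from h); omega
    · have := blockStart_mono b (show i + 1 ≤ blockIndex b t from h); omega

lemma blockIndex_mono {b : ℕ → ℕ} (hb : ∀ i, 1 ≤ b i) : Monotone (blockIndex b) := by
  intro s t hst
  by_contra! h
  have h1 := blockIndex_spec hb s
  have h2 := blockIndex_spec hb t
  have := blockStart_mono b (show blockIndex b t + 1 ≤ blockIndex b s from h)
  omega

/-- The number of positions of block `i` among the first `n` positions. -/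
def cap (b : ℕ → ℕ) (n i : ℕ) : ℕ := min n (blockStart b (i + 1)) - min n (blockStart b i)

lemma count_blockIndex {b : ℕ → ℕ} (hb : ∀ i, 1 ≤ b i) (n i : ℕ) :
    ((List.range n).map (blockIndex b)).count i = cap b n i := by
  unfold cap
  have hm := blockStart_mono b (Nat.le_succ i)
  induction n with
  | zero => simp
  | succ n ih =>
    rw [List.range_succ, List.map_append, List.count_append, ih]
    have := blockIndex_eq_iff hb n i
    simp only [List.map_cons, List.map_nil, List.count_singleton, beq_iff_eq]
    split_ifs with h
    · have := this.1 h; simp only [Nat.succ_eq_add_one] at *; omega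
    · rw [this] at h; simp only [Nat.succ_eq_add_one] at *; omega

lemma cap_le (b : ℕ → ℕ) (n i : ℕ) : cap b n i ≤ b i := by
  unfold cap; rw [blockStart_succ]; omega

lemma cap_eq {b : ℕ → ℕ} {n i : ℕ} (h : blockStart b (i + 1) ≤ n) : cap b n i = b i := by
  unfold cap; rw [blockStart_succ] at *; omega

lemma sum_cap (b : ℕ → ℕ) (n N : ℕ) :
    ∑ i ∈ Finset.range N, cap b n i = min n (blockStart b N) := by
  induction N with
  | zero => simp [blockStart]
  | succ N ih =>
    rw [Finset.sum_range_succ, ih, cap]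
    have := blockStart_mono b (Nat.le_succ N)
    simp only [Nat.succ_eq_add_one] at *
    omega

lemma cap_eq_zero {b : ℕ → ℕ} {n i : ℕ} (h : n ≤ blockStart b i) : cap b n i = 0 := by
  unfold cap; omega

/-! ### Alignments of blocks -/

/-- A block alignment: a monotone list of pairs of block indices of equal colour (up to the
convention `p` on the colours of the first blocks) that uses each block of the first sequence at
most `a i` times and each block of the second one at most `b j` times. -/
structure IsAlignment (p : Prop) (a b : ℕ → ℕ) (w : List (ℕ × ℕ)) : Prop where
  pairwise : w.Pairwise (· ≤ ·)
  count_fst : ∀ i, (w.map Prod.fst).count i ≤ a i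
  count_snd : ∀ j, (w.map Prod.snd).count j ≤ b j
  parity : ∀ x ∈ w, ((Even x.1 ↔ Even x.2) ↔ p)

/-- The colour of block `i` when block `0` has colour `c`. -/
def colour (c : Bool) (i : ℕ) : Bool := if Even i then c else !c

lemma blockString_eq (c : Bool) (b : ℕ → ℕ) (n : ℕ) :
    blockString c b n = ((List.range n).map (blockIndex b)).map (colour c) := by
  simp [blockString, blockSeq, colour, Function.comp_def]

lemma colour_eq_iff (c d : Bool) (i j : ℕ) :
    colour c i = colour d j ↔ ((Even i ↔ Even j) ↔ c = d) := by
  unfold colour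
  by_cases hi : Even i <;> by_cases hj : Even j <;> cases c <;> cases d <;> simp [hi, hj]

/-! ### Common subsequences as block alignments. -/

lemma lcs_bddAbove {α : Type*} (x y : List α) :
    BddAbove {k : ℕ | ∃ z : List α, z.Sublist x ∧ z.Sublist y ∧ z.length = k} :=
  ⟨x.length, by rintro k ⟨z, hz, -, rfl⟩; exact hz.length_le⟩

lemma length_le_lcsLength {α : Type*} {x y z : List α} (hx : z.Sublist x) (hy : z.Sublist y) :
    z.length ≤ lcsLength x y :=
  le_csSup (lcs_bddAbove x y) ⟨z, hx, hy, rfl⟩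

lemma exists_lcs {α : Type*} (x y : List α) :
    ∃ z : List α, z.Sublist x ∧ z.Sublist y ∧ z.length = lcsLength x y :=
  Nat.sSup_mem (s := {k : ℕ | ∃ z : List α, z.Sublist x ∧ z.Sublist y ∧ z.length = k})
    ⟨0, [], by simp, by simp, rfl⟩ (lcs_bddAbove x y)

/-- Between sorted lists, the sublist relation reduces to a comparison of multiplicities. -/
lemma sublist_blockIndex {b : ℕ → ℕ} (hb : ∀ i, 1 ≤ b i) {n : ℕ} {u : List ℕ}
    (hu : u.Pairwise (· ≤ ·)) (hc : ∀ i, u.count i ≤ cap b n i) :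
    u.Sublist ((List.range n).map (blockIndex b)) := by
  refine List.sublist_of_subperm_of_pairwise (r := (· ≤ ·)) ?_ hu ?_
  · rw [List.subperm_ext_iff]
    intro x _
    rw [count_blockIndex hb]
    exact hc x
  · rw [List.pairwise_map]
    exact List.pairwise_lt_range.imp fun h => blockIndex_mono hb h.le

lemma IsAlignment.length_le {cX cY : Bool} {bX bY : ℕ → ℕ} (hX : ∀ i, 1 ≤ bX i)
    (hY : ∀ i, 1 ≤ bY i) {n : ℕ} {w : List (ℕ × ℕ)}
    (h : IsAlignment (cX = cY) (cap bX n) (cap bY n) w) :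
    w.length ≤ lcsLength (blockString cX bX n) (blockString cY bY n) := by
  have h1 : (w.map Prod.fst).Sublist ((List.range n).map (blockIndex bX)) :=
    sublist_blockIndex hX (List.pairwise_map.2 (h.pairwise.imp fun h => h.1)) h.count_fst
  have h2 : (w.map Prod.snd).Sublist ((List.range n).map (blockIndex bY)) :=
    sublist_blockIndex hY (List.pairwise_map.2 (h.pairwise.imp fun h => h.2)) h.count_snd
  have e : (w.map Prod.fst).map (colour cX) = (w.map Prod.snd).map (colour cY) := by
    rw [List.map_map, List.map_map]
    refine List.map_congr_left fun x hx => ?_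
    exact (colour_eq_iff _ _ _ _).2 (h.parity x hx)
  have := length_le_lcsLength (x := blockString cX bX n) (y := blockString cY bY n)
    (z := (w.map Prod.fst).map (colour cX))
    (by rw [blockString_eq]; exact h1.map _) (by rw [blockString_eq, e]; exact h2.map _)
  simpa using this

/-- Record, for each symbol of a longest common subsequence, the blocks of $X$ and $Y$ in which it
is realised. With `IsAlignment.length_le`, this makes the LCS the maximal length of an alignment. -/
lemma exists_isAlignment (cX cY : Bool) {bX bY : ℕ → ℕ} (hX : ∀ i, 1 ≤ bX i)
    (hY : ∀ i, 1 ≤ bY i) (n : ℕ) :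
    ∃ w, IsAlignment (cX = cY) (cap bX n) (cap bY n) w ∧
      w.length = lcsLength (blockString cX bX n) (blockString cY bY n) := by
  obtain ⟨z, h1, h2, hz⟩ := exists_lcs (blockString cX bX n) (blockString cY bY n)
  rw [blockString_eq, List.sublist_map_iff] at h1 h2
  obtain ⟨u, hu, rfl⟩ := h1
  obtain ⟨v, hv, huv⟩ := h2
  have hlen : u.length = v.length := by simpa using congrArg List.length huv
  have e1 : (u.zip v).map Prod.fst = u := List.map_fst_zip hlen.le
  have e2 : (u.zip v).map Prod.snd = v := List.map_snd_zip hlen.ge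
  have mono : ∀ {b : ℕ → ℕ}, (∀ i, 1 ≤ b i) → ∀ {u : List ℕ},
      u.Sublist ((List.range n).map (blockIndex b)) → u.Pairwise (· ≤ ·) := by
    intro b hb u hu
    refine List.Pairwise.sublist hu ?_
    rw [List.pairwise_map]
    exact List.pairwise_lt_range.imp fun h => blockIndex_mono hb h.le
  refine ⟨u.zip v, ⟨?_, ?_, ?_, ?_⟩, ?_⟩
  · have a1 := mono hX hu
    have a2 := mono hY hv
    rw [← e1, List.pairwise_map] at a1
    rw [← e2, List.pairwise_map] at a2
    exact (a1.and a2).imp fun h => ⟨h.1, h.2⟩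
  · intro i
    rw [e1, ← count_blockIndex hX]
    exact hu.count_le i
  · intro i
    rw [e2, ← count_blockIndex hY]
    exact hv.count_le i
  · intro x hx
    rw [← colour_eq_iff]
    have e : ((u.zip v).map Prod.fst).map (colour cX) = ((u.zip v).map Prod.snd).map (colour cY) := by
      rw [e1, e2]; exact huv
    rw [List.map_map, List.map_map] at e
    exact List.map_inj_left.1 e x hx
  · rw [← hz, List.length_map, List.length_zip, ← hlen, min_self]

lemma IsAlignment.sublist {p : Prop} {a b : ℕ → ℕ} {w w' : List (ℕ × ℕ)}
    (h : IsAlignment p a b w) (hw : w'.Sublist w) : IsAlignment p a b w' :=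
  ⟨h.pairwise.sublist hw, fun i => ((hw.map _).count_le i).trans (h.count_fst i),
    fun i => ((hw.map _).count_le i).trans (h.count_snd i), fun x hx => h.parity x (hw.subset hx)⟩

/-- Lowering the capacities of the first sequence costs at most the total decrease. -/
lemma IsAlignment.exists_of_capacity {p : Prop} {a a' b : ℕ → ℕ} {N : ℕ}
    (haN : ∀ i, N ≤ i → a i = 0) {w : List (ℕ × ℕ)} (h : IsAlignment p a b w) :
    ∃ w', IsAlignment p a' b w' ∧ w.length ≤ w'.length + ∑ i ∈ Finset.range N, (a i - a' i) := by
  -- Induction on the total excess `s` of the multiplicities over the new capacities: erasing one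
  -- pair from an overfull block lowers it by exactly one.
  suffices H : ∀ (s : ℕ) (w : List (ℕ × ℕ)), IsAlignment p a b w →
      ∑ i ∈ Finset.range N, ((w.map Prod.fst).count i - a' i) = s →
      ∃ w', IsAlignment p a' b w' ∧ w.length ≤ w'.length + s by
    obtain ⟨w', hw', hl⟩ := H _ w h rfl
    refine ⟨w', hw', hl.trans ?_⟩
    gcongr with i hi
    exact h.count_fst i
  intro s
  induction s with
  | zero =>
    intro w h hs
    refine ⟨w, ⟨h.pairwise, fun i => ?_, h.count_snd, h.parity⟩, by simp⟩
    by_cases hi : i < N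
    · have := (Finset.sum_eq_zero_iff.1 hs) i (Finset.mem_range.2 hi); omega
    · have := h.count_fst i; rw [haN i (by omega)] at this; omega
  | succ s ih =>
    intro w h hs
    obtain ⟨i, hi, hne⟩ : ∃ i ∈ Finset.range N, (w.map Prod.fst).count i - a' i ≠ 0 := by
      by_contra! hcon
      rw [Finset.sum_eq_zero hcon] at hs
      omega
    have hmem : i ∈ w.map Prod.fst := List.count_pos_iff.1 (by omega)
    obtain ⟨x, hx, rfl⟩ := List.mem_map.1 hmem
    have hperm := (List.perm_cons_erase hx).map Prod.fst
    have hcount : ∀ i, (w.map Prod.fst).count i =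
        ((w.erase x).map Prod.fst).count i + if x.1 = i then 1 else 0 := by
      intro i
      rw [hperm.count_eq, List.map_cons, List.count_cons]
      simp
    obtain ⟨w', hw', hl⟩ := ih (w.erase x) (h.sublist List.erase_sublist) (by
      rw [← Finset.add_sum_erase _ _ hi] at hs ⊢
      have e : ∑ k ∈ (Finset.range N).erase x.1, ((w.map Prod.fst).count k - a' k) =
          ∑ k ∈ (Finset.range N).erase x.1, (((w.erase x).map Prod.fst).count k - a' k) := by
        refine Finset.sum_congr rfl fun k hk => ?_
        rw [hcount k, if_neg (Finset.ne_of_mem_erase hk).symm, add_zero]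
      have e2 := hcount x.1
      rw [if_pos rfl] at e2
      omega)
    refine ⟨w', hw', ?_⟩
    have := List.length_erase_add_one hx
    omega

/-- Duplicating a pair next to itself preserves monotonicity; this is how an alignment gains a
symbol. -/
lemma exists_insert {w : List (ℕ × ℕ)} (h : w.Pairwise (· ≤ ·)) {x : ℕ × ℕ} (hx : x ∈ w) :
    ∃ w' : List (ℕ × ℕ), w'.Pairwise (· ≤ ·) ∧ w'.Perm (x :: w) := by
  obtain ⟨s, t, rfl⟩ := List.append_of_mem hx
  refine ⟨s ++ x :: x :: t, ?_, ?_⟩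
  · rw [List.pairwise_append] at h ⊢
    refine ⟨h.1, ?_, ?_⟩
    · rw [List.pairwise_cons]
      refine ⟨fun y hy => ?_, h.2.1⟩
      rcases List.mem_cons.1 hy with rfl | hy
      · exact le_rfl
      · exact (List.pairwise_cons.1 h.2.1).1 y hy
    · intro y hy z hz
      rcases List.mem_cons.1 hz with rfl | hz
      · exact h.2.2 y hy z (by simp)
      · exact h.2.2 y hy z hz
  · exact List.perm_middle

/-! ### Effect of changing block lengths -/

/-- The length of the longest common subsequences of two strings of `n` symbols that are given by
their first symbols and block lengths. -/
noncomputable def lcsBlocks (n : ℕ) (cX cY : Bool) (bX bY : ℕ → ℕ) : ℕ :=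
  lcsLength (blockString cX bX n) (blockString cY bY n)

lemma lcsLength_comm {α : Type*} (x y : List α) : lcsLength x y = lcsLength y x := by
  unfold lcsLength
  congr 1
  ext k
  constructor <;> rintro ⟨z, h1, h2, h3⟩ <;> exact ⟨z, h2, h1, h3⟩

lemma lcsBlocks_comm (n : ℕ) (cX cY : Bool) (bX bY : ℕ → ℕ) :
    lcsBlocks n cX cY bX bY = lcsBlocks n cY cX bY bX := lcsLength_comm _ _

lemma lcsBlocks_le_of_cap {n : ℕ} (cX cY : Bool) {bX bX' bY : ℕ → ℕ} (hX : ∀ i, 1 ≤ bX i)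
    (hX' : ∀ i, 1 ≤ bX' i) (hY : ∀ i, 1 ≤ bY i) :
    lcsBlocks n cX cY bX bY ≤
      lcsBlocks n cX cY bX' bY + ∑ i ∈ Finset.range n, (cap bX n i - cap bX' n i) := by
  obtain ⟨w, hw, hl⟩ := exists_isAlignment cX cY hX hY n
  obtain ⟨w', hw', hl'⟩ := hw.exists_of_capacity (a' := cap bX' n) (N := n)
    fun i hi => cap_eq_zero (hi.trans (le_blockStart hX i))
  have := hw'.length_le hX' hY
  unfold lcsBlocks
  omega

lemma blockStart_update (b : ℕ → ℕ) (i v k : ℕ) :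
    blockStart (Function.update b i v) k + (if i < k then b i else 0) =
      blockStart b k + if i < k then v else 0 := by
  induction k with
  | zero => simp [blockStart]
  | succ k ih =>
    rw [blockStart_succ, blockStart_succ]
    rcases lt_trichotomy i k with h | rfl | h
    · rw [Function.update_of_ne h.ne']
      simp only [h, Nat.lt_succ_of_lt h, if_true] at ih ⊢
      omega
    · simp at ih ⊢; omega
    · rw [Function.update_of_ne h.ne]
      have h1 : ¬ i < k := by omega
      have h2 : ¬ i < k + 1 := by omega
      simp only [h1, h2, if_false] at ih ⊢
      omega

/-- Shortening block `i` pulls later blocks to the left, so only the capacity of block `i` can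
decrease. -/
lemma sum_cap_update_sub_le (b : ℕ → ℕ) (n N i v : ℕ) (h : v ≤ b i) :
    ∑ k ∈ Finset.range N, (cap b n k - cap (Function.update b i v) n k) ≤ b i - v := by
  calc _ ≤ ∑ k ∈ Finset.range N, (if k = i then b i - v else 0) := by
        refine Finset.sum_le_sum fun k _ => ?_
        have h1 := blockStart_update b i v k
        have h2 := blockStart_update b i v (k + 1)
        have h3 := blockStart_mono b (Nat.le_succ k)
        have h4 := blockStart_mono (Function.update b i v) (Nat.le_succ k)
        unfold cap
        simp only [Nat.succ_eq_add_one] at h3 h4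
        rcases lt_trichotomy i k with h | rfl | h
        · have h5 : i < k + 1 := by omega
          simp only [h, h5, if_true] at h1 h2
          rw [if_neg h.ne']
          omega
        · simp at h1 h2 ⊢; omega
        · have h5 : ¬ i < k := by omega
          have h6 : ¬ i < k + 1 := by omega
          simp only [h5, h6, if_false] at h1 h2
          rw [if_neg h.ne]
          omega
    _ ≤ b i - v := by
        rw [Finset.sum_ite_eq']
        split_ifs <;> omega

lemma sum_sub_eq_sum_sub {N : ℕ} {f g : ℕ → ℕ}
    (h : ∑ i ∈ Finset.range N, f i = ∑ i ∈ Finset.range N, g i) :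
    ∑ i ∈ Finset.range N, (f i - g i) = ∑ i ∈ Finset.range N, (g i - f i) := by
  have : ∑ i ∈ Finset.range N, (f i - g i) + ∑ i ∈ Finset.range N, g i =
      ∑ i ∈ Finset.range N, (g i - f i) + ∑ i ∈ Finset.range N, f i := by
    rw [← Finset.sum_add_distrib, ← Finset.sum_add_distrib]
    exact Finset.sum_congr rfl fun i _ => by omega
  omega

lemma update_pos {b : ℕ → ℕ} (hb : ∀ i, 1 ≤ b i) {i v : ℕ} (hv : 1 ≤ v) :
    ∀ k, 1 ≤ Function.update b i v k := by
  intro k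
  by_cases h : k = i
  · subst h; simpa using hv
  · rw [Function.update_of_ne h]; exact hb k

/-- Changing one block length by at most `d` changes the length of the longest common subsequences
by at most `d`. -/
lemma lcsBlocks_le_update {n : ℕ} (cX cY : Bool) {bX bY : ℕ → ℕ} (hX : ∀ i, 1 ≤ bX i)
    (hY : ∀ i, 1 ≤ bY i) {i v d : ℕ} (hv : 1 ≤ v) (h1 : v ≤ bX i + d) (h2 : bX i ≤ v + d) :
    lcsBlocks n cX cY bX bY ≤ lcsBlocks n cX cY (Function.update bX i v) bY + d := by
  have hX' := update_pos hX (i := i) hv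
  refine (lcsBlocks_le_of_cap cX cY hX hX' hY).trans (Nat.add_le_add_left ?_ _)
  rcases le_total v (bX i) with h | h
  · exact (sum_cap_update_sub_le bX n n i v h).trans (by omega)
  -- Lengthening is the reverse of shortening: both capacity vectors have total `n`, so the total
  -- decrease equals the total increase.
  · rw [sum_sub_eq_sum_sub]
    · have := sum_cap_update_sub_le (Function.update bX i v) n n i (bX i) (by simpa using h)
      rw [Function.update_idem, Function.update_eq_self] at this
      refine this.trans ?_
      simp only [Function.update_self]
      omega
    · rw [sum_cap, sum_cap, min_eq_left (le_blockStart hX n), min_eq_left (le_blockStart hX' n)]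

lemma abs_lcsBlocks_update_sub_le {n : ℕ} (cX cY : Bool) {bX bY : ℕ → ℕ} (hX : ∀ i, 1 ≤ bX i)
    (hY : ∀ i, 1 ≤ bY i) {i v d : ℕ} (hv : 1 ≤ v) (h1 : v ≤ bX i + d) (h2 : bX i ≤ v + d) :
    |(lcsBlocks n cX cY (Function.update bX i v) bY : ℝ) - lcsBlocks n cX cY bX bY| ≤ d := by
  have e1 := lcsBlocks_le_update (n := n) cX cY hX hY hv h1 h2
  have e2 := lcsBlocks_le_update (n := n) cX cY (update_pos hX (i := i) hv) hY (i := i) (v := bX i)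
    (d := d) (hX i) (by simpa using h2) (by simpa using h1)
  rw [Function.update_idem, Function.update_eq_self] at e2
  have e1' : (lcsBlocks n cX cY bX bY : ℝ) ≤
    lcsBlocks n cX cY (Function.update bX i v) bY + d := by exact_mod_cast e1
  have e2' : (lcsBlocks n cX cY (Function.update bX i v) bY : ℝ) ≤
    lcsBlocks n cX cY bX bY + d := by exact_mod_cast e2
  rw [abs_le]
  constructor <;> linarith

/-- Deleting the first block of the second sequence exchanges its colours. -/
lemma lcsBlocks_le_shift {n : ℕ} (cX cY : Bool) {bX bY bY' : ℕ → ℕ} (hX : ∀ i, 1 ≤ bX i)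
    (hY : ∀ i, 1 ≤ bY i) (hY' : ∀ i, 1 ≤ bY' i) {N : ℕ} (hN : n ≤ blockStart bY (N + 1))
    (hs : ∀ j < N, bY' j = bY (j + 1)) :
    lcsBlocks n cX cY bX bY ≤ lcsBlocks n cX (!cY) bX bY' + bY 0 := by
  have hstart : ∀ j ≤ N, blockStart bY (j + 1) = blockStart bY' j + bY 0 := by
    intro j hj
    induction j with
    | zero => simp [blockStart]
    | succ j ih => rw [blockStart_succ, ih (by omega), blockStart_succ, hs j (by omega)]; omega
  have hcap : ∀ j, cap bY n (j + 1) ≤ cap bY' n j := by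
    intro j
    by_cases hj : j < N
    · have h1 := hstart j hj.le
      have h2 := hstart (j + 1) hj
      have := blockStart_mono bY' (Nat.le_succ j)
      unfold cap
      simp only [Nat.succ_eq_add_one] at this
      omega
    · rw [cap_eq_zero (hN.trans (blockStart_mono _ (by omega)))]
      exact Nat.zero_le _
  obtain ⟨w, hw, hl⟩ := exists_isAlignment cX cY hX hY n
  -- Drop the pairs that use block 0 of $Y$, at most `bY 0` of them, and renumber the remaining
  -- blocks of $Y$ down by one, which reverses the parity condition.
  set u := w.filter fun x => x.2 ≠ 0 with hu
  have huw : u.Sublist w := List.filter_sublist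
  have hpos : ∀ x ∈ u, x.2 ≠ 0 := fun x hx => by simpa using (List.mem_filter.1 hx).2
  have hua := hw.sublist huw
  have hlen : w.length ≤ u.length + bY 0 := by
    have h1 := List.length_eq_countP_add_countP (fun x : ℕ × ℕ => decide (x.2 ≠ 0)) (l := w)
    have h2 : (w.map Prod.snd).count 0 ≤ bY 0 := (hw.count_snd 0).trans (cap_le _ _ _)
    rw [List.count_eq_countP, List.countP_map] at h2
    rw [List.countP_eq_length_filter, ← hu] at h1
    rw [h1]
    gcongr
    refine le_trans (le_of_eq ?_) h2
    congr 1
    ext x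
    by_cases h : x.2 = 0 <;> simp [h]
  have hA : IsAlignment (cX = !cY) (cap bX n) (cap bY' n) (u.map fun x => (x.1, x.2 - 1)) := by
    refine ⟨?_, ?_, ?_, ?_⟩
    · rw [List.pairwise_map]
      exact hua.pairwise.imp fun h => ⟨h.1, Nat.sub_le_sub_right h.2 1⟩
    · intro i; simpa [Function.comp_def] using hua.count_fst i
    · intro j
      refine le_trans (le_of_eq ?_) ((hua.count_snd (j + 1)).trans (hcap j))
      rw [List.map_map, List.count_eq_countP, List.countP_map, List.count_eq_countP,
        List.countP_map]
      refine List.countP_congr fun x hx => ?_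
      have := hpos x hx
      simp only [Function.comp, beq_iff_eq]
      omega
    · intro x hx
      obtain ⟨y, hy, rfl⟩ := List.mem_map.1 hx
      have h1 := hua.parity y hy
      obtain ⟨m, hm⟩ := Nat.exists_eq_succ_of_ne_zero (hpos y hy)
      rw [hm, Nat.succ_eq_add_one, Nat.even_add_one] at h1
      simp only [hm, Nat.succ_eq_add_one, Nat.add_sub_cancel]
      have : (cX = !cY) ↔ ¬ cX = cY := by cases cX <;> cases cY <;> simp
      rw [this, ← h1]
      tauto
  have := hA.length_le hX hY'
  rw [List.length_map] at this
  unfold lcsBlocks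
  omega

/-- Matching the blocks in order gives a first lower bound. -/
lemma mul_le_lcsBlocks {n : ℕ} (cX cY : Bool) {bX bY : ℕ → ℕ} {d K : ℕ} (hd : 1 ≤ d)
    (hX : ∀ i, d ≤ bX i) (hY : ∀ i, d ≤ bY i) (hXn : blockStart bX (K + 1) ≤ n)
    (hYn : blockStart bY (K + 1) ≤ n) : d * K ≤ lcsBlocks n cX cY bX bY := by
  -- Block `i` of $X$ is matched with block `i + e` of $Y$; the shift `e` makes the colours agree
  -- and is the reason for `K + 1` blocks in the hypotheses.
  obtain ⟨e, he1, he⟩ : ∃ e : ℕ, e ≤ 1 ∧ ((Even e) ↔ cX = cY) := by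
    by_cases h : cX = cY
    · exact ⟨0, by omega, by simp [h]⟩
    · exact ⟨1, by omega, by simp [h]⟩
  have key : ∀ K : ℕ, ∃ w : List (ℕ × ℕ), w.Pairwise (· ≤ ·) ∧ w.length = d * K ∧
      (∀ i, (w.map Prod.fst).count i ≤ if i < K then d else 0) ∧
      (∀ i, (w.map Prod.snd).count i ≤ if i < K + e then d else 0) ∧
      ∀ x ∈ w, x.2 = x.1 + e ∧ x.1 < K := by
    intro K
    induction K with
    | zero => exact ⟨[], by simp⟩
    | succ K ih =>
      obtain ⟨w, h1, h2, h3, h4, h5⟩ := ih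
      refine ⟨w ++ List.replicate d (K, K + e), ?_, ?_, ?_, ?_, ?_⟩
      · rw [List.pairwise_append]
        refine ⟨h1, ?_, ?_⟩
        · rw [List.pairwise_replicate]; exact Or.inr le_rfl
        · intro x hx y hy
          rw [List.eq_of_mem_replicate hy]
          have := h5 x hx
          exact ⟨by simp; omega, by simp; omega⟩
      · simp [h2, Nat.mul_succ]
      · intro i
        rw [List.map_append, List.count_append, List.map_replicate, List.count_replicate]
        have := h3 i
        simp only [beq_iff_eq]
        split_ifs at this ⊢ <;> omega
      · intro i
        rw [List.map_append, List.count_append, List.map_replicate, List.count_replicate]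
        have := h4 i
        simp only [beq_iff_eq]
        split_ifs at this ⊢ <;> omega
      · intro x hx
        rcases List.mem_append.1 hx with hx | hx
        · have := h5 x hx; omega
        · rw [List.eq_of_mem_replicate hx]; simp
  obtain ⟨w, h1, h2, h3, h4, h5⟩ := key K
  have hA : IsAlignment (cX = cY) (cap bX n) (cap bY n) w := by
    refine ⟨h1, fun i => (h3 i).trans ?_, fun i => (h4 i).trans ?_, fun x hx => ?_⟩
    · split_ifs with h
      · rw [cap_eq ((blockStart_mono _ (by omega)).trans hXn)]; exact hX i
      · exact Nat.zero_le _
    · split_ifs with h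
      · rw [cap_eq ((blockStart_mono _ (by omega)).trans hYn)]; exact hY i
      · exact Nat.zero_le _
    · rw [(h5 x hx).1, ← he, Nat.even_add]
      tauto
  rw [← h2]
  exact hA.length_le (fun i => hd.trans (hX i)) (fun i => hd.trans (hY i))

/-- Two isolated blocks of an alignment may be replaced by a longer and a shorter one. -/
lemma IsAlignment.exists_transfer {p : Prop} {a a' b : ℕ → ℕ} {w : List (ℕ × ℕ)}
    (h : IsAlignment p a b w) {i₁ i₂ j₁ j₂ : ℕ} (hi : i₁ ≠ i₂) (ha₁ : a' i₁ = a i₁ + 1)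
    (ha₂ : a' i₂ + 1 = a i₂) (ha : ∀ i, i ≠ i₁ → i ≠ i₂ → a' i = a i)
    (hm₁ : (i₁, j₁) ∈ w) (hm₂ : (i₂, j₂) ∈ w) (hs₁ : ∀ x ∈ w, x.1 = i₁ ↔ x.2 = j₁)
    (hs₂ : ∀ x ∈ w, x.1 = i₂ ↔ x.2 = j₂) :
    ∃ w', IsAlignment p a' b w' ∧
      (w.length : ℤ) + (if a i₁ + 1 ≤ b j₁ then 1 else 0) - (if a i₂ ≤ b j₂ then 1 else 0) ≤
        w'.length := by
  have hcount : ∀ {u : List (ℕ × ℕ)}, u.Sublist w → ∀ {i j : ℕ}, (∀ x ∈ w, x.1 = i ↔ x.2 = j) →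
      (u.map Prod.fst).count i = (u.map Prod.snd).count j := by
    intro u hu i j hs
    rw [List.count_eq_countP, List.countP_map, List.count_eq_countP, List.countP_map]
    refine List.countP_congr fun x hx => ?_
    simpa using hs x (hu.subset hx)
  -- A pair has to be erased only if block `i₂` is used to full capacity; isolation then forces `a
  -- i₂ ≤ b j₂`, so the loss is accounted for.
  obtain ⟨u, hu, hu₂, hul, hmu⟩ : ∃ u : List (ℕ × ℕ), u.Sublist w ∧
      (u.map Prod.fst).count i₂ ≤ a' i₂ ∧
      (w.length : ℤ) - (if a i₂ ≤ b j₂ then 1 else 0) ≤ u.length ∧ (i₁, j₁) ∈ u := by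
    by_cases hc : (w.map Prod.fst).count i₂ ≤ a' i₂
    · exact ⟨w, List.Sublist.refl _, hc, by split_ifs <;> omega, hm₁⟩
    · have h1 := h.count_fst i₂
      have h2 := h.count_snd j₂
      rw [← hcount (List.Sublist.refl w) hs₂] at h2
      refine ⟨w.erase (i₂, j₂), List.erase_sublist, ?_, ?_, ?_⟩
      · have := ((List.perm_cons_erase hm₂).map Prod.fst).count_eq i₂
        simp only [List.map_cons, List.count_cons_self] at this
        omega
      · rw [if_pos (by omega)]
        have := List.length_erase_add_one hm₂
        omega
      · exact (List.mem_erase_of_ne (by simp [hi])).2 hm₁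
  have hua := h.sublist hu
  have hle : ∀ i, (u.map Prod.fst).count i ≤ a' i := by
    intro i
    by_cases h2 : i = i₂
    · rw [h2]; exact hu₂
    · refine (hua.count_fst i).trans ?_
      by_cases h1 : i = i₁
      · rw [h1]; omega
      · rw [ha i h1 h2]
  -- By isolation `j₁` is used as often as `i₁`, at most `a i₁` times, so it has room for one more
  -- symbol. Optimality of `w` plays no role.
  by_cases hg : a i₁ + 1 ≤ b j₁
  · obtain ⟨v, hv, hvu⟩ := exists_insert hua.pairwise hmu
    refine ⟨v, ⟨hv, fun i => ?_, fun j => ?_, fun x hx => ?_⟩, ?_⟩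
    · rw [(hvu.map Prod.fst).count_eq, List.map_cons, List.count_cons]
      by_cases h1 : i = i₁
      · subst h1
        have := hua.count_fst i
        simp only [beq_self_eq_true, if_true]
        omega
      · rw [if_neg (by simpa using Ne.symm h1)]
        exact hle i
    · rw [(hvu.map Prod.snd).count_eq, List.map_cons, List.count_cons]
      by_cases h1 : j = j₁
      · subst h1
        have := hua.count_fst i₁
        rw [hcount hu hs₁] at this
        simp only [beq_self_eq_true, if_true]
        omega
      · rw [if_neg (by simpa using Ne.symm h1)]
        exact hua.count_snd j
    · rcases List.mem_cons.1 (hvu.subset hx) with rfl | hx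
      · exact hua.parity _ hmu
      · exact hua.parity _ hx
    · rw [if_pos hg, hvu.length_eq, List.length_cons]
      push_cast
      omega
  · refine ⟨u, ⟨hua.pairwise, hle, hua.count_snd, hua.parity⟩, ?_⟩
    rw [if_neg hg]
    omega

/-! ### Matched blocks of an alignment with few empty blocks -/

/-- Fibrewise: a fibre of size $s\ge 2$ contributes $s\le 2(s-1)$ non-unique points, a singleton
none. -/
lemma card_nonunique_add_le {α β : Type*} [DecidableEq α] [DecidableEq β] (D : Finset α)
    (f : α → β) :
    (D.filter fun x => ∃ y ∈ D, y ≠ x ∧ f y = f x).card + 2 * (D.image f).card ≤ 2 * D.card := by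
  set A := D.filter fun x => ∃ y ∈ D, y ≠ x ∧ f y = f x with hA
  have h1 : A.card = ∑ b ∈ D.image f, (A.filter fun x => f x = b).card :=
    Finset.card_eq_sum_card_fiberwise fun x hx =>
      Finset.mem_coe.2 (Finset.mem_image_of_mem f (Finset.mem_filter.1 hx).1)
  have h2 : D.card = ∑ b ∈ D.image f, (D.filter fun x => f x = b).card :=
    Finset.card_eq_sum_card_fiberwise fun x hx => Finset.mem_coe.2 (Finset.mem_image_of_mem f hx)
  rw [h1, h2, Finset.card_eq_sum_ones, Finset.mul_sum, Finset.mul_sum, ← Finset.sum_add_distrib]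
  refine Finset.sum_le_sum fun b hb => ?_
  have hsub : (A.filter fun x => f x = b) ⊆ D.filter fun x => f x = b :=
    Finset.filter_subset_filter _ (Finset.filter_subset _ _)
  have hpos : 0 < (D.filter fun x => f x = b).card := by
    obtain ⟨x, hx, rfl⟩ := Finset.mem_image.1 hb
    exact Finset.card_pos.2 ⟨x, by simp [hx]⟩
  have hle := Finset.card_le_card hsub
  rcases (A.filter fun x => f x = b).eq_empty_or_nonempty with he | ⟨x, hx⟩
  · rw [he, Finset.card_empty]; omega
  · obtain ⟨hxA, hxb⟩ := Finset.mem_filter.1 hx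
    obtain ⟨hxD, y, hy, hyx, hfy⟩ := Finset.mem_filter.1 hxA
    have : 1 < (D.filter fun x => f x = b).card :=
      Finset.one_lt_card.2 ⟨x, by simp [hxD, hxb], y, by simp [hy, hfy, hxb], hyx.symm⟩
    omega

/-- The pairs of `Γ` share no coordinate with any other pair of `D`. -/
def Isolated (D Γ : Finset (ℕ × ℕ)) : Prop :=
  Γ ⊆ D ∧ ∀ x ∈ Γ, ∀ y ∈ D, x.1 = y.1 ∨ x.2 = y.2 → y = x

/-- The parity condition gives $|D|\le N$, while both projections have at least $N-z$ elements.
Hence at most $2z$ pairs share a first coordinate and at most $2z$ share a second one. The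
coordinates in $[m,N)$ exclude at most $2(N-m)$ further isolated pairs. -/
lemma exists_isolated {D : Finset (ℕ × ℕ)} {N z m : ℕ} {p : Prop}
    (hchain : ∀ x ∈ D, ∀ y ∈ D, x ≤ y ∨ y ≤ x)
    (hpar : ∀ x ∈ D, ((Even x.1 ↔ Even x.2) ↔ p)) (hD : ∀ x ∈ D, x.1 < N ∧ x.2 < N)
    (h1 : N ≤ (D.image Prod.fst).card + z) (h2 : N ≤ (D.image Prod.snd).card + z) :
    ∃ Γ, Isolated D Γ ∧ (∀ x ∈ Γ, x.1 < m ∧ x.2 < m) ∧ N ≤ Γ.card + 4 * z + 2 * (N - m) := by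
  have hcard : D.card ≤ N := by
    rw [← Finset.card_range N]
    refine Finset.card_le_card_of_injOn (fun x => (x.1 + x.2) / 2) (fun x hx => ?_) ?_
    · have := hD x hx
      simp only [Finset.coe_range, Set.mem_Iio]
      omega
    · intro x hx y hy hxy
      have hx' := hpar x hx
      have hy' := hpar y hy
      have e : ((Even x.1 ↔ Even x.2) ↔ (Even y.1 ↔ Even y.2)) := hx'.trans hy'.symm
      simp only [Nat.even_iff] at e hxy
      ext
      · rcases hchain x hx y hy with h | h <;> have := h.1 <;> have := h.2 <;> omega
      · rcases hchain x hx y hy with h | h <;> have := h.1 <;> have := h.2 <;> omega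
  set A₁ := D.filter fun x => ∃ y ∈ D, y ≠ x ∧ y.1 = x.1
  set A₂ := D.filter fun x => ∃ y ∈ D, y ≠ x ∧ y.2 = x.2
  have hA₁ : A₁.card + 2 * (D.image Prod.fst).card ≤ 2 * D.card := card_nonunique_add_le D _
  have hA₂ : A₂.card + 2 * (D.image Prod.snd).card ≤ 2 * D.card := card_nonunique_add_le D _
  set Γ := D.filter fun x => ∀ y ∈ D, x.1 = y.1 ∨ x.2 = y.2 → y = x with hΓ
  have hΓD : Γ ⊆ D := Finset.filter_subset _ _
  have hiso : ∀ x ∈ Γ, ∀ y ∈ D, x.1 = y.1 ∨ x.2 = y.2 → y = x :=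
    fun x hx => (Finset.mem_filter.1 hx).2
  have hcov : D ⊆ Γ ∪ (A₁ ∪ A₂) := by
    intro x hx
    by_contra hcon
    simp only [Finset.mem_union, not_or] at hcon
    refine hcon.1 (Finset.mem_filter.2 ⟨hx, fun y hy h => ?_⟩)
    by_contra hne
    rcases h with h | h
    · exact hcon.2.1 (Finset.mem_filter.2 ⟨hx, y, hy, hne, h.symm⟩)
    · exact hcon.2.2 (Finset.mem_filter.2 ⟨hx, y, hy, hne, h.symm⟩)
  have hc := (Finset.card_le_card hcov).trans
    ((Finset.card_union_le _ _).trans (Nat.add_le_add_left (Finset.card_union_le _ _) _))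
  have him : (D.image Prod.fst).card ≤ D.card := Finset.card_image_le
  have hout₁ : (Γ.filter fun x => ¬ x.1 < m).card ≤ N - m := by
    rw [← Nat.card_Ico]
    refine Finset.card_le_card_of_injOn Prod.fst (fun x hx => ?_) fun x hx y hy hxy => ?_
    · have hx := Finset.mem_filter.1 hx
      have := hD x (hΓD hx.1)
      simp only [Finset.coe_Ico, Set.mem_Ico]
      omega
    · exact hiso y (Finset.mem_filter.1 hy).1 x (hΓD (Finset.mem_filter.1 hx).1) (Or.inl hxy.symm)
  have hout₂ : (Γ.filter fun x => ¬ x.2 < m).card ≤ N - m := by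
    rw [← Nat.card_Ico]
    refine Finset.card_le_card_of_injOn Prod.snd (fun x hx => ?_) fun x hx y hy hxy => ?_
    · have hx := Finset.mem_filter.1 hx
      have := hD x (hΓD hx.1)
      simp only [Finset.coe_Ico, Set.mem_Ico]
      omega
    · exact hiso y (Finset.mem_filter.1 hy).1 x (hΓD (Finset.mem_filter.1 hx).1) (Or.inr hxy.symm)
  refine ⟨Γ.filter fun x => x.1 < m ∧ x.2 < m, ⟨(Finset.filter_subset _ _).trans hΓD, ?_⟩, ?_, ?_⟩
  · exact fun x hx => hiso x (Finset.mem_filter.1 hx).1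
  · exact fun x hx => (Finset.mem_filter.1 hx).2
  · have hcov' : Γ ⊆ (Γ.filter fun x => x.1 < m ∧ x.2 < m) ∪
        ((Γ.filter fun x => ¬ x.1 < m) ∪ Γ.filter fun x => ¬ x.2 < m) := by
      intro x hx
      simp only [Finset.mem_union, Finset.mem_filter, hx, true_and]
      tauto
    have hc' := (Finset.card_le_card hcov').trans
      ((Finset.card_union_le _ _).trans (Nat.add_le_add_left (Finset.card_union_le _ _) _))
    omega

/-! ### Encoding a matching by its unmatched blocks. -/

/-- The partner of `i` when the `r`-th natural number outside `S` is matched with the `r`-th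
natural number outside `T`. -/
noncomputable def partner (S T : Finset ℕ) (i : ℕ) : ℕ :=
  Nat.nth (fun j => j ∉ T) (Nat.count (fun i => i ∉ S) i)

/-- Isolated pairs of a chain increase strictly in both coordinates, so the `r`-th first coordinate
belongs to the `r`-th second one. `S` and `T` are the complements of the projections of `Γ`. -/
lemma exists_partner {D Γ : Finset (ℕ × ℕ)} {m : ℕ} (hchain : ∀ x ∈ D, ∀ y ∈ D, x ≤ y ∨ y ≤ x)
    (hΓ : Isolated D Γ) (hm : ∀ x ∈ Γ, x.1 < m ∧ x.2 < m) :
    ∃ S T : Finset ℕ, S ⊆ Finset.range m ∧ T ⊆ Finset.range m ∧ S.card + Γ.card = m ∧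
      T.card + Γ.card = m ∧ Set.InjOn (partner S T) (Finset.range m \ S : Finset ℕ) ∧
      ∀ i ∈ Finset.range m \ S, (i, partner S T i) ∈ Γ := by
  have hinj₁ : Set.InjOn Prod.fst (Γ : Set (ℕ × ℕ)) := fun x hx y hy h =>
    hΓ.2 y hy x (hΓ.1 hx) (Or.inl h.symm)
  have hinj₂ : Set.InjOn Prod.snd (Γ : Set (ℕ × ℕ)) := fun x hx y hy h =>
    hΓ.2 y hy x (hΓ.1 hx) (Or.inr h.symm)
  have hsub₁ : Γ.image Prod.fst ⊆ Finset.range m := by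
    intro i hi
    obtain ⟨x, hx, rfl⟩ := Finset.mem_image.1 hi
    exact Finset.mem_range.2 (hm x hx).1
  have hsub₂ : Γ.image Prod.snd ⊆ Finset.range m := by
    intro i hi
    obtain ⟨x, hx, rfl⟩ := Finset.mem_image.1 hi
    exact Finset.mem_range.2 (hm x hx).2
  have hcount₁ : ∀ i < m, Nat.count (fun i => i ∉ Finset.range m \ Γ.image Prod.fst) i =
      (Γ.filter fun y => y.1 < i).card := by
    intro i hi
    rw [Nat.count_eq_card_filter_range, ← Finset.card_image_of_injOn
      (hinj₁.mono (Finset.coe_subset.2 (Finset.filter_subset (fun y => y.1 < i) Γ)))]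
    congr 1
    ext k
    simp only [Finset.mem_filter, Finset.mem_range, Finset.mem_sdiff, Finset.mem_image, not_and,
      not_not]
    constructor
    · rintro ⟨hk, h⟩
      obtain ⟨x, hx, rfl⟩ := h (hk.trans hi)
      exact ⟨x, ⟨hx, hk⟩, rfl⟩
    · rintro ⟨x, ⟨hx, hk⟩, rfl⟩
      exact ⟨hk, fun _ => ⟨x, hx, rfl⟩⟩
  have hcount₂ : ∀ i < m, Nat.count (fun i => i ∉ Finset.range m \ Γ.image Prod.snd) i =
      (Γ.filter fun y => y.2 < i).card := by
    intro i hi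
    rw [Nat.count_eq_card_filter_range, ← Finset.card_image_of_injOn
      (hinj₂.mono (Finset.coe_subset.2 (Finset.filter_subset (fun y => y.2 < i) Γ)))]
    congr 1
    ext k
    simp only [Finset.mem_filter, Finset.mem_range, Finset.mem_sdiff, Finset.mem_image, not_and,
      not_not]
    constructor
    · rintro ⟨hk, h⟩
      obtain ⟨x, hx, rfl⟩ := h (hk.trans hi)
      exact ⟨x, ⟨hx, hk⟩, rfl⟩
    · rintro ⟨x, ⟨hx, hk⟩, rfl⟩
      exact ⟨hk, fun _ => ⟨x, hx, rfl⟩⟩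
  have hpartner : ∀ x ∈ Γ, partner (Finset.range m \ Γ.image Prod.fst)
      (Finset.range m \ Γ.image Prod.snd) x.1 = x.2 := by
    intro x hx
    have hfil : (Γ.filter fun y => y.1 < x.1) = Γ.filter fun y => y.2 < x.2 := by
      refine Finset.filter_congr fun y hy => ?_
      have h1 : x.1 = y.1 → y = x := fun h => hΓ.2 x hx y (hΓ.1 hy) (Or.inl h)
      have h2 : x.2 = y.2 → y = x := fun h => hΓ.2 x hx y (hΓ.1 hy) (Or.inr h)
      constructor
      · intro hlt
        rcases hchain x (hΓ.1 hx) y (hΓ.1 hy) with h | h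
        · exact absurd h.1 (by omega)
        · refine lt_of_le_of_ne h.2 fun he => ?_
          rw [h2 he.symm] at hlt
          exact lt_irrefl _ hlt
      · intro hlt
        rcases hchain x (hΓ.1 hx) y (hΓ.1 hy) with h | h
        · exact absurd h.2 (by omega)
        · refine lt_of_le_of_ne h.1 fun he => ?_
          rw [h1 he.symm] at hlt
          exact lt_irrefl _ hlt
    unfold partner
    rw [hcount₁ x.1 (hm x hx).1, hfil, ← hcount₂ x.2 (hm x hx).2]
    refine Nat.nth_count (p := fun i => i ∉ Finset.range m \ Γ.image Prod.snd) ?_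
    simp only [Finset.mem_sdiff, Finset.mem_image, not_and, not_not]
    exact fun _ => ⟨x, hx, rfl⟩
  have hmem : ∀ i ∈ Finset.range m \ (Finset.range m \ Γ.image Prod.fst), ∃ x ∈ Γ, x.1 = i := by
    intro i hi
    rw [Finset.sdiff_sdiff_eq_self hsub₁] at hi
    exact Finset.mem_image.1 hi
  refine ⟨Finset.range m \ Γ.image Prod.fst, Finset.range m \ Γ.image Prod.snd,
    Finset.sdiff_subset, Finset.sdiff_subset, ?_, ?_, ?_, ?_⟩
  · have := Finset.card_sdiff_add_card_eq_card hsub₁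
    rwa [Finset.card_image_of_injOn hinj₁, Finset.card_range] at this
  · have := Finset.card_sdiff_add_card_eq_card hsub₂
    rwa [Finset.card_image_of_injOn hinj₂, Finset.card_range] at this
  · intro i hi i' hi' h
    obtain ⟨x, hx, rfl⟩ := hmem i (Finset.mem_coe.1 hi)
    obtain ⟨y, hy, rfl⟩ := hmem i' (Finset.mem_coe.1 hi')
    rw [hpartner x hx, hpartner y hy] at h
    rw [hinj₂ hx hy h]
  · intro i hi
    obtain ⟨x, hx, rfl⟩ := hmem i hi
    rw [hpartner x hx]
    exact hx

/-! ### Averages and variances over finite types -/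

section Average

variable {α β : Type*} [Fintype α] [Fintype β]

/-- The average of a function on a finite type. -/
noncomputable def avg (f : α → ℝ) : ℝ := (∑ x, f x) / Fintype.card α

/-- The variance of a function on a finite type with respect to the uniform distribution. -/
noncomputable def uvar (f : α → ℝ) : ℝ := avg (fun x => f x ^ 2) - avg f ^ 2

lemma avg_add (f g : α → ℝ) : avg (fun x => f x + g x) = avg f + avg g := by
  simp [avg, Finset.sum_add_distrib, add_div]

lemma avg_sub (f g : α → ℝ) : avg (fun x => f x - g x) = avg f - avg g := by
  simp [avg, Finset.sum_sub_distrib, sub_div]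

lemma avg_mul_left (c : ℝ) (f : α → ℝ) : avg (fun x => c * f x) = c * avg f := by
  simp [avg, ← Finset.mul_sum, mul_div_assoc]

lemma avg_sum {ι : Type*} (I : Finset ι) (f : ι → α → ℝ) :
    avg (fun x => ∑ i ∈ I, f i x) = ∑ i ∈ I, avg (f i) := by
  unfold avg
  rw [Finset.sum_comm, Finset.sum_div]

lemma avg_mono {f g : α → ℝ} (h : ∀ x, f x ≤ g x) : avg f ≤ avg g := by
  unfold avg
  gcongr with x
  exact h x

lemma avg_const [Nonempty α] (c : ℝ) : avg (fun _ : α => c) = c := by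
  simp [avg]

lemma avg_nonneg {f : α → ℝ} (h : ∀ x, 0 ≤ f x) : 0 ≤ avg f :=
  div_nonneg (Finset.sum_nonneg fun x _ => h x) (Nat.cast_nonneg _)

lemma avg_comp_equiv (e : α ≃ β) (f : β → ℝ) : avg (fun x => f (e x)) = avg f := by
  simp [avg, Equiv.sum_comp e f, Fintype.card_congr e]

lemma avg_prod (f : α × β → ℝ) : avg f = avg fun a => avg fun b => f (a, b) := by
  unfold avg
  rw [Fintype.sum_prod_type, Fintype.card_prod, ← Finset.sum_div, div_div]
  push_cast
  rw [mul_comm]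

lemma uvar_comp_equiv (e : α ≃ β) (f : β → ℝ) : uvar (fun x => f (e x)) = uvar f := by
  unfold uvar
  rw [avg_comp_equiv e f, avg_comp_equiv e fun x => f x ^ 2]

lemma uvar_sub_const [Nonempty α] (f : α → ℝ) (c : ℝ) : uvar (fun x => f x - c) = uvar f := by
  have e : ∀ x, (f x - c) ^ 2 = f x ^ 2 - 2 * c * f x + c ^ 2 := fun x => by ring
  unfold uvar
  simp only [e]
  rw [avg_add, avg_sub, avg_mul_left, avg_const, avg_sub, avg_const]
  ring

lemma uvar_le_of_osc [Nonempty α] {f : α → ℝ} {C : ℝ} (h : ∀ x y, |f x - f y| ≤ C) :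
    uvar f ≤ C ^ 2 := by
  obtain ⟨a⟩ := ‹Nonempty α›
  rw [← uvar_sub_const f (f a)]
  have : avg (fun x => (f x - f a) ^ 2) ≤ avg fun _ : α => C ^ 2 :=
    avg_mono fun x => sq_le_sq' (abs_le.1 (h x a)).1 (abs_le.1 (h x a)).2
  rw [avg_const] at this
  unfold uvar
  nlinarith [sq_nonneg (avg fun x => f x - f a)]

/-- Law of total variance. -/
lemma uvar_prod (f : α × β → ℝ) :
    uvar f = avg (fun a => uvar fun b => f (a, b)) + uvar fun a => avg fun b => f (a, b) := by
  unfold uvar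
  rw [avg_sub, avg_prod (fun x => f x ^ 2), avg_prod f]
  ring

lemma uvar_prod_le [Nonempty α] {f : α × β → ℝ} {u v : ℝ}
    (h₁ : ∀ a, uvar (fun b => f (a, b)) ≤ u) (h₂ : uvar (fun a => avg fun b => f (a, b)) ≤ v) :
    uvar f ≤ u + v := by
  rw [uvar_prod]
  have := avg_mono h₁
  rw [avg_const] at this
  linarith

lemma abs_avg_sub_le [Nonempty α] {f g : α → ℝ} {C : ℝ} (h : ∀ x, |f x - g x| ≤ C) :
    |avg f - avg g| ≤ C := by
  rw [← avg_sub, abs_le]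
  have h1 := avg_mono fun x => (abs_le.1 (h x)).1
  have h2 := avg_mono fun x => (abs_le.1 (h x)).2
  rw [avg_const] at h1 h2
  exact ⟨h1, h2⟩

/-- The Efron–Stein bound for functions with bounded differences. -/
lemma uvar_pi_le [Nonempty α] {C : ℝ} (N : ℕ) (f : (Fin N → α) → ℝ)
    (h : ∀ x i v, |f (Function.update x i v) - f x| ≤ C) : uvar f ≤ N * C ^ 2 := by
  induction N with
  | zero =>
    have := uvar_le_of_osc (f := f) (C := 0) fun x y => by simp [Subsingleton.elim x y]
    simpa using this
  | succ N ih =>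
    rw [← uvar_comp_equiv (Fin.consEquiv fun _ : Fin (N + 1) => α) f]
    have h1 : uvar (fun a : α × (Fin N → α) => f (Fin.consEquiv (fun _ : Fin (N + 1) => α) a)) ≤
        N * C ^ 2 + C ^ 2 := by
      -- Condition on coordinate 0: the conditional variance is handled by induction, and the
      -- conditional mean still oscillates by at most `C`.
      refine uvar_prod_le (fun a => ih _ fun x i v => ?_) (uvar_le_of_osc fun a a' => ?_)
      · have := h (Fin.cons a x) i.succ v
        rwa [← Fin.cons_update] at this
      · refine abs_avg_sub_le fun x => ?_
        have := h (Fin.cons a' x) 0 a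
        rwa [Fin.update_cons_zero] at this
    push_cast
    linarith

/-- Cauchy–Schwarz after centring `f`, which is free because `g` has mean zero. -/
lemma sq_avg_mul_le [Nonempty α] (f g : α → ℝ) (hg : avg g = 0) :
    avg (fun x => f x * g x) ^ 2 ≤ uvar f * avg fun x => g x ^ 2 := by
  have e : avg (fun x => f x * g x) = avg fun x => (f x - avg f) * g x := by
    simp only [sub_mul]
    rw [avg_sub, avg_mul_left, hg, mul_zero, sub_zero]
  have e2 : uvar f = avg fun x => (f x - avg f) ^ 2 := by
    rw [← uvar_sub_const f (avg f), uvar, avg_sub, avg_const]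
    ring
  rw [e, e2]
  unfold avg
  rw [div_pow, div_mul_div_comm, sq (Fintype.card α : ℝ)]
  gcongr
  exact Finset.sum_mul_sq_le_sq_mul_sq _ _ _

lemma avg_pi_prod {N : ℕ} (g : Fin N → α → ℝ) :
    avg (fun y : Fin N → α => ∏ j, g j (y j)) = ∏ j, avg (g j) := by
  classical
  unfold avg
  rw [Finset.prod_div_distrib, Finset.prod_univ_sum, Fintype.piFinset_univ]
  simp

/-- Independence of distinct coordinates under the uniform law. -/
lemma avg_prod_of_injOn [Nonempty α] {ι : Type*} {N : ℕ} (I : Finset ι) (φ : ι → Fin N)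
    (hφ : Set.InjOn φ I) (h : ι → α → ℝ) :
    avg (fun y : Fin N → α => ∏ i ∈ I, h i (y (φ i))) = ∏ i ∈ I, avg (h i) := by
  classical
  have e : ∀ y : Fin N → α, ∏ i ∈ I, h i (y (φ i)) =
      ∏ j, ∏ i ∈ I.filter fun i => φ i = j, h i (y j) := by
    intro y
    rw [← Finset.prod_fiberwise I φ]
    refine Finset.prod_congr rfl fun j _ => Finset.prod_congr rfl fun i hi => ?_
    rw [(Finset.mem_filter.1 hi).2]
  simp only [e]
  rw [avg_pi_prod fun j v => ∏ i ∈ I.filter fun i => φ i = j, h i v, ← Finset.prod_fiberwise I φ]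
  refine Finset.prod_congr rfl fun j _ => ?_
  have hc : (I.filter fun i => φ i = j).card ≤ 1 := by
    refine Finset.card_le_one.2 fun a ha b hb => ?_
    rw [Finset.mem_filter] at ha hb
    exact hφ ha.1 hb.1 (ha.2.trans hb.2.symm)
  rcases Nat.le_one_iff_eq_zero_or_eq_one.1 hc with h0 | h0
  · simp [Finset.card_eq_zero.1 h0, avg_const]
  · obtain ⟨x, hx⟩ := Finset.card_eq_one.1 h0
    simp [hx]

lemma avg_update {N : ℕ} [DecidableEq α] (f : (Fin N → α) → ℝ) (k : Fin N) (u v : α) :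
    avg (fun x => if x k = u then f x else 0) =
      avg fun x => if x k = v then f (Function.update x k u) else 0 := by
  unfold avg
  congr 1
  rw [← Finset.sum_filter, ← Finset.sum_filter]
  refine Finset.sum_nbij' (fun x => Function.update x k v) (fun x => Function.update x k u)
    ?_ ?_ ?_ ?_ ?_
  · intro x _; simp
  · intro x _; simp
  · intro x hx
    have : x k = u := (Finset.mem_filter.1 hx).2
    simp [← this]
  · intro x hx
    have : x k = v := (Finset.mem_filter.1 hx).2
    simp [← this]
  · intro x hx
    have : x k = u := (Finset.mem_filter.1 hx).2
    simp [← this]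

end Average

/-! ### The typical gain over all matchings -/

/-- The gain at a block of the first sequence that is matched with a block of offset `v` when the
pair of offsets `u` (of this block and of its neighbour) is replaced by `(1, 1)`. -/
noncomputable def gain (u : Fin 3 × Fin 3) (v : Fin 3) : ℝ :=
  if u = (0, 2) then (if 1 ≤ v then 1 else 0) else if u = (2, 0) then (if v = 2 then -1 else 0)
  else 0

lemma exp_neg_log_two : Real.exp (-Real.log 2) = 1 / 2 := by
  rw [Real.exp_neg, Real.exp_log (by norm_num)]; norm_num

lemma exp_gain (u : Fin 3 × Fin 3) (v : Fin 3) : Real.exp (-Real.log 2 * gain u v) =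
    if u = (0, 2) then (if 1 ≤ v then 1 / 2 else 1) else if u = (2, 0) then (if v = 2 then 2 else 1)
    else 1 := by
  unfold gain
  split_ifs <;> simp [Real.exp_log, Real.exp_neg]

/-- For $u=(0,2)$ or $(2,0)$ the two inner averages are $2/3$ and $4/3$, with product $8/9$; the
other seven values of $u$ give 1. Thus $7/9+(2/9)(8/9)=79/81<1$. -/
lemma avg_exp_gain :
    avg (fun u : Fin 3 × Fin 3 => avg (fun v : Fin 3 => Real.exp (-Real.log 2 * gain u v)) *
      avg (fun v : Fin 3 => Real.exp (-Real.log 2 * gain u.swap v))) = 79 / 81 := by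
  simp only [exp_gain]
  unfold avg
  simp only [Fintype.sum_prod_type, Fin.sum_univ_three, Prod.swap, Fintype.card_prod,
    Fintype.card_fin]
  simp [Fin.ext_iff, Prod.ext_iff, Fin.le_def]
  norm_num

/-- `partner S T i` as an element of `Fin N` (with a default value when it is too large). -/
noncomputable def partnerFin {N : ℕ} (hN : 0 < N) (S T : Finset ℕ) (i : ℕ) : Fin N :=
  if h : partner S T i < N then ⟨partner S T i, h⟩ else ⟨0, hN⟩

/-- The pairs of blocks, among the first `M`, that are not met by `S`. -/
def freePairs {N' : ℕ} (M : ℕ) (S : Finset ℕ) : Finset (Fin N') :=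
  Finset.univ.filter fun k => k.1 < M ∧ 2 * k.1 ∉ S ∧ 2 * k.1 + 1 ∉ S

lemma le_card_freePairs {N' M : ℕ} (h : M ≤ N') (S : Finset ℕ) :
    M ≤ (freePairs (N' := N') M S).card + S.card := by
  have h1 : Finset.range M ⊆ (freePairs (N' := N') M S).image Fin.val ∪ S.image (· / 2) := by
    intro k hk
    have hk := Finset.mem_range.1 hk
    simp only [Finset.mem_union, Finset.mem_image]
    by_cases h1 : 2 * k ∈ S
    · exact Or.inr ⟨_, h1, by omega⟩
    by_cases h2 : 2 * k + 1 ∈ S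
    · exact Or.inr ⟨_, h2, by omega⟩
    exact Or.inl ⟨⟨k, hk.trans_le h⟩, by simp [freePairs, hk, h1, h2], rfl⟩
  have h2 := (Finset.card_le_card h1).trans (Finset.card_union_le _ _)
  rw [Finset.card_range] at h2
  exact h2.trans (Nat.add_le_add Finset.card_image_le Finset.card_image_le)

/-- The total gain over all pairs of blocks met neither by `S` nor by `T`. -/
noncomputable def score {N' N : ℕ} (hN : 0 < N) (M : ℕ) (S T : Finset ℕ)
    (x : Fin N' → Fin 3 × Fin 3) (y : Fin N → Fin 3) : ℝ :=
  ∑ k ∈ freePairs M S, (gain (x k) (y (partnerFin hN S T (2 * k))) +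
    gain (x k).swap (y (partnerFin hN S T (2 * k + 1))))

/-- For a fixed matching, the partners are distinct blocks of $Y$. The exponential moment therefore
factorises over $y$ for each $x$, and then over the pairs of $x$. -/
lemma avg_exp_score {N' N : ℕ} (hN : 0 < N) (M : ℕ) (S T : Finset ℕ)
    (hinj : Set.InjOn (partnerFin hN S T) (Finset.range (2 * M) \ S : Finset ℕ)) :
    avg (fun x : Fin N' → Fin 3 × Fin 3 => avg fun y : Fin N → Fin 3 =>
      Real.exp (-Real.log 2 * score hN M S T x y)) =
      (79 / 81) ^ (freePairs (N' := N') M S).card := by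
  have hy : ∀ x : Fin N' → Fin 3 × Fin 3, (avg fun y : Fin N → Fin 3 =>
      Real.exp (-Real.log 2 * score hN M S T x y)) = ∏ k ∈ freePairs M S,
        avg (fun v : Fin 3 => Real.exp (-Real.log 2 * gain (x k) v)) *
        avg (fun v : Fin 3 => Real.exp (-Real.log 2 * gain (x k).swap v)) := by
    intro x
    have h := avg_prod_of_injOn (α := Fin 3) (freePairs M S ×ˢ (Finset.univ : Finset (Fin 2)))
      (fun i : Fin N' × Fin 2 => partnerFin hN S T (2 * i.1 + i.2)) (by
        rintro ⟨k, b⟩ hk ⟨k', b'⟩ hk' he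
        have hmem : ∀ (k : Fin N') (b : Fin 2),
            (k, b) ∈ (freePairs M S ×ˢ (Finset.univ : Finset (Fin 2))) →
            2 * k.1 + b.1 ∈ Finset.range (2 * M) \ S := by
          intro k b hkb
          simp only [freePairs, Finset.mem_product, Finset.mem_filter, Finset.mem_univ, true_and,
            and_true] at hkb
          rw [Finset.mem_sdiff, Finset.mem_range]
          obtain ⟨b, hb⟩ := b
          interval_cases b
          · exact ⟨by simp only; omega, hkb.2.1⟩
          · exact ⟨by simp only; omega, hkb.2.2⟩
        have := hinj (hmem k b hk) (hmem k' b' hk') he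
        ext <;> simp only <;> omega)
      (fun i v => Real.exp (-Real.log 2 * gain (if i.2 = 0 then x i.1 else (x i.1).swap) v))
    simp only [Finset.prod_product, Fin.prod_univ_two] at h
    simp only [Fin.isValue, Fin.val_zero, add_zero, if_true, Fin.val_one, one_ne_zero,
      if_false] at h
    rw [← h]
    congr 1
    ext y
    unfold score
    rw [Finset.mul_sum, Real.exp_sum]
    refine Finset.prod_congr rfl fun k _ => ?_
    rw [mul_add, Real.exp_add]
  simp only [hy]
  rw [avg_prod_of_injOn (freePairs M S) (fun k : Fin N' => k) (fun _ _ _ _ h => h)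
    (fun _ u => avg (fun v : Fin 3 => Real.exp (-Real.log 2 * gain u v)) *
      avg (fun v : Fin 3 => Real.exp (-Real.log 2 * gain u.swap v)))]
  rw [avg_exp_gain, Finset.prod_const]

/-- The codes of matchings: pairs of sets of unmatched blocks. -/
noncomputable def codes {N : ℕ} (hN : 0 < N) (M : ℕ) : Finset (Finset ℕ × Finset ℕ) :=
  open scoped Classical in
  ((Finset.range (2 * M)).powerset ×ˢ (Finset.range (2 * M)).powerset).filter fun A =>
    Set.InjOn (partnerFin hN A.1 A.2) (Finset.range (2 * M) \ A.1 : Finset ℕ)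

lemma exp_ten_mul (c : ℕ) : Real.exp (-Real.log 2 * (10 * c)) = (1 / 1024) ^ c := by
  have : -Real.log 2 * (10 * (c : ℝ)) = ((10 * c : ℕ) : ℝ) * (-Real.log 2) := by push_cast; ring
  rw [this, Real.exp_nat_mul, exp_neg_log_two, pow_mul]
  norm_num

/-- The charge of 10 per unmatched block becomes a weight $2^{-10}$, small enough that summing over
all subsets costs only $(1+1/512)^{2M}(1+1/1024)^{2M}$, which the slack between $79/81$ and $80/81$
absorbs. -/
lemma sum_codes_le {N' N M : ℕ} (hN : 0 < N) (hM : M ≤ N') :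
    ∑ A ∈ codes hN M, avg (fun x : Fin N' → Fin 3 × Fin 3 => avg fun y : Fin N → Fin 3 =>
      Real.exp (-Real.log 2 * (score hN M A.1 A.2 x y + 10 * ((A.1.card + A.2.card : ℕ) : ℝ)))) ≤
      (80 / 81) ^ M := by
  have h1 : ∀ A ∈ codes hN M, avg (fun x : Fin N' → Fin 3 × Fin 3 => avg fun y : Fin N → Fin 3 =>
      Real.exp (-Real.log 2 * (score hN M A.1 A.2 x y + 10 * ((A.1.card + A.2.card : ℕ) : ℝ)))) ≤
      (79 / 81) ^ M * ((1 / 512) ^ A.1.card * (1 / 1024) ^ A.2.card) := by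
    intro A hA
    have hinj := (Finset.mem_filter.1 hA).2
    have e : ∀ (x : Fin N' → Fin 3 × Fin 3) (y : Fin N → Fin 3),
        Real.exp (-Real.log 2 * (score hN M A.1 A.2 x y + 10 * ((A.1.card + A.2.card : ℕ) : ℝ))) =
        (1 / 1024) ^ (A.1.card + A.2.card) * Real.exp (-Real.log 2 * score hN M A.1 A.2 x y) := by
      intro x y
      rw [mul_add, Real.exp_add, exp_ten_mul, mul_comm]
    simp only [e, avg_mul_left]
    rw [avg_exp_score hN M A.1 A.2 hinj]
    have hc := le_card_freePairs (N' := N') hM A.1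
    -- Each element of `A.1` destroys at most one free pair, hence costs a factor of at most
    -- $81/79\le 2$; this turns $1/1024$ into $1/512$.
    have h2 : ((79 : ℝ) / 81) ^ (freePairs (N' := N') M A.1).card ≤ (79 / 81) ^ M * 2 ^ A.1.card := by
      have h3 : ((79 : ℝ) / 81) ^ ((freePairs (N' := N') M A.1).card + A.1.card) ≤ (79 / 81) ^ M :=
        pow_le_pow_of_le_one (by norm_num) (by norm_num) hc
      have h4 : (1 : ℝ) ≤ ((79 / 81) * 2) ^ A.1.card := one_le_pow₀ (by norm_num)
      calc ((79 : ℝ) / 81) ^ (freePairs (N' := N') M A.1).card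
          ≤ (79 / 81) ^ (freePairs (N' := N') M A.1).card * ((79 / 81) * 2) ^ A.1.card :=
            le_mul_of_one_le_right (by positivity) h4
        _ = (79 / 81) ^ ((freePairs (N' := N') M A.1).card + A.1.card) * 2 ^ A.1.card := by
            rw [mul_pow, pow_add]; ring
        _ ≤ _ := by gcongr
    calc ((1 : ℝ) / 1024) ^ (A.1.card + A.2.card) * (79 / 81) ^ (freePairs (N' := N') M A.1).card
        ≤ (1 / 1024) ^ (A.1.card + A.2.card) * ((79 / 81) ^ M * 2 ^ A.1.card) := by gcongr
      _ = _ := by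
          have : ((1 : ℝ) / 512) = (1 / 1024) * 2 := by norm_num
          rw [this, mul_pow, pow_add]; ring
  refine (Finset.sum_le_sum h1).trans ?_
  have h2 : ∑ A ∈ codes hN M, ((79 : ℝ) / 81) ^ M * ((1 / 512) ^ A.1.card * (1 / 1024) ^ A.2.card) ≤
      ∑ A ∈ (Finset.range (2 * M)).powerset ×ˢ (Finset.range (2 * M)).powerset,
        ((79 : ℝ) / 81) ^ M * ((1 / 512) ^ A.1.card * (1 / 1024) ^ A.2.card) :=
    Finset.sum_le_sum_of_subset_of_nonneg (Finset.filter_subset _ _) fun A _ _ => by positivity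
  refine h2.trans ?_
  rw [← Finset.mul_sum, Finset.sum_product' (f := fun S T : Finset ℕ =>
    ((1 : ℝ) / 512) ^ S.card * (1 / 1024) ^ T.card), ← Finset.sum_mul_sum]
  have h3 : ∀ q : ℝ, ∑ S ∈ (Finset.range (2 * M)).powerset, q ^ S.card = (q + 1) ^ (2 * M) := by
    intro q
    have := Finset.sum_pow_mul_eq_add_pow q 1 (Finset.range (2 * M))
    simpa using this
  rw [h3, h3, pow_mul, pow_mul, ← mul_pow, ← mul_pow]
  exact pow_le_pow_left₀ (by norm_num) (by norm_num) M

/-- On average the gain of a matching that depends on the configuration is at least linear, up to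
the cost of describing the matching. -/
lemma le_avg_score {N' N M : ℕ} (hN : 0 < N) (hM : M ≤ N')
    (A : (Fin N' → Fin 3 × Fin 3) → (Fin N → Fin 3) → Finset ℕ × Finset ℕ)
    (hA : ∀ x y, A x y ∈ codes hN M) :
    (M : ℝ) / 81 ≤ avg fun x : Fin N' → Fin 3 × Fin 3 => avg fun y : Fin N → Fin 3 =>
      score hN M (A x y).1 (A x y).2 x y + 10 * (((A x y).1.card + (A x y).2.card : ℕ) : ℝ) := by
  set F : Finset ℕ × Finset ℕ → (Fin N' → Fin 3 × Fin 3) → (Fin N → Fin 3) → ℝ :=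
    fun A x y => score hN M A.1 A.2 x y + 10 * ((A.1.card + A.2.card : ℕ) : ℝ) with hF
  change _ ≤ avg fun x => avg fun y => F (A x y) x y
  -- The term of the configuration-dependent code is bounded by the sum over all codes, which
  -- removes the dependence. Then $1+t\le e^t$ linearises before averaging.
  have h1 : ∀ x y, Real.exp ((M : ℝ) / 81) * Real.exp (-Real.log 2 * F (A x y) x y) ≤
      Real.exp ((M : ℝ) / 81) * ∑ B ∈ codes hN M, Real.exp (-Real.log 2 * F B x y) := by
    intro x y
    gcongr
    exact Finset.single_le_sum (f := fun B => Real.exp (-Real.log 2 * F B x y))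
      (fun B _ => (Real.exp_pos _).le) (hA x y)
  have h2 : ∀ x y, 1 + ((M : ℝ) / 81 - Real.log 2 * F (A x y) x y) ≤
      Real.exp ((M : ℝ) / 81) * ∑ B ∈ codes hN M, Real.exp (-Real.log 2 * F B x y) := by
    intro x y
    refine le_trans ?_ (h1 x y)
    rw [← Real.exp_add]
    have := Real.add_one_le_exp ((M : ℝ) / 81 + -Real.log 2 * F (A x y) x y)
    linarith
  have h3 := avg_mono fun x => avg_mono fun y => h2 x y
  simp only [avg_add, avg_sub, avg_mul_left, avg_const, avg_sum] at h3
  have h4 := sum_codes_le (N' := N') hN hM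
  have h5 : Real.exp ((M : ℝ) / 81) * (80 / 81) ^ M ≤ 1 := by
    have : Real.exp ((M : ℝ) / 81) = Real.exp (1 / 81) ^ M := by
      rw [← Real.exp_nat_mul]; congr 1; ring
    rw [this, ← mul_pow]
    refine pow_le_one₀ (by positivity) ?_
    have h6 := Real.add_one_le_exp (-(1 / 81 : ℝ))
    have h7 : Real.exp (1 / 81) * Real.exp (-(1 / 81)) = 1 := by rw [← Real.exp_add]; simp
    nlinarith [Real.exp_pos (1 / 81)]
  have h8 : Real.exp ((M : ℝ) / 81) * ∑ B ∈ codes hN M, avg (fun x : Fin N' → Fin 3 × Fin 3 =>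
      avg fun y : Fin N → Fin 3 => Real.exp (-Real.log 2 * F B x y)) ≤ 1 :=
    le_trans (by gcongr) h5
  have hl1 : 0 < Real.log 2 := Real.log_pos (by norm_num)
  have hl2 : Real.log 2 ≤ 1 := by have := Real.log_le_sub_one_of_pos (show (0 : ℝ) < 2 by norm_num); linarith
  have hM0 : (0 : ℝ) ≤ (M : ℝ) / 81 := by positivity
  have h9 : (M : ℝ) / 81 ≤ Real.log 2 * avg fun x => avg fun y => F (A x y) x y := by linarith
  have h10 : 0 ≤ avg fun x => avg fun y => F (A x y) x y := by
    by_contra! hneg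
    nlinarith
  nlinarith

/-! ### The alignment structure for given block lengths -/

lemma IsAlignment.isChain {p : Prop} {a b : ℕ → ℕ} {w : List (ℕ × ℕ)} (h : IsAlignment p a b w) :
    ∀ x ∈ w.toFinset, ∀ y ∈ w.toFinset, x ≤ y ∨ y ≤ x := by
  intro x hx y hy
  have : Std.Symm fun x y : ℕ × ℕ => x ≤ y ∨ y ≤ x := ⟨fun _ _ h => Or.symm h⟩
  exact List.Pairwise.forall_of_forall (R := fun x y : ℕ × ℕ => x ≤ y ∨ y ≤ x)
    (fun x _ => Or.inl (le_refl x)) (h.pairwise.imp Or.inl) (List.mem_toFinset.1 hx)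
    (List.mem_toFinset.1 hy)

lemma length_le_card_image_mul {w : List (ℕ × ℕ)} (f : ℕ × ℕ → ℕ) {c : ℕ}
    (h : ∀ i, (w.map f).count i ≤ c) : w.length ≤ (w.toFinset.image f).card * c := by
  have h1 := List.sum_toFinset_count_eq_length (w.map f)
  have h2 : (w.map f).toFinset = w.toFinset.image f := by ext; simp
  rw [List.length_map, h2] at h1
  rw [← h1, ← smul_eq_mul]
  exact Finset.sum_le_card_nsmul _ _ _ fun i _ => h i

lemma mul_le_blockStart {b : ℕ → ℕ} {d : ℕ} (h : ∀ i, d ≤ b i) (k : ℕ) : k * d ≤ blockStart b k := by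
  have := Finset.card_nsmul_le_sum (Finset.range k) b d fun i _ => h i
  simpa [blockStart] using this

lemma blockStart_le_mul {b : ℕ → ℕ} {d : ℕ} (h : ∀ i, b i ≤ d) (k : ℕ) : blockStart b k ≤ k * d := by
  have := Finset.sum_le_card_nsmul (Finset.range k) b d fun i _ => h i
  simpa [blockStart] using this

/-- An optimal alignment leaves few blocks unmatched, and its matched blocks are described by a
code of small size. -/
lemma exists_code {n l M N z : ℕ} (hl : 2 ≤ l) (hM : 1 ≤ M) (hN : 0 < N) (hMN : 2 * M ≤ N)
    (hn : n ≤ N * (l - 1)) (hnM : 2 * M * (l + 1) ≤ n)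
    (hz : N * (l + 1) ≤ (l - 1) * (2 * M - 1) + z * (l + 1)) (cX cY : Bool) {bX bY : ℕ → ℕ}
    (hX : ∀ i, l - 1 ≤ bX i) (hX' : ∀ i, bX i ≤ l + 1) (hY : ∀ i, l - 1 ≤ bY i)
    (hY' : ∀ i, bY i ≤ l + 1) :
    ∃ w, IsAlignment (cX = cY) (cap bX n) (cap bY n) w ∧ w.length = lcsBlocks n cX cY bX bY ∧
      ∃ A ∈ codes hN M, A.1.card ≤ 4 * z + 2 * (N - 2 * M) ∧ A.2.card ≤ 4 * z + 2 * (N - 2 * M) ∧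
        ∀ i ∈ Finset.range (2 * M) \ A.1, (i, (partnerFin hN A.1 A.2 i : ℕ)) ∈ w ∧
          (partnerFin hN A.1 A.2 i : ℕ) < 2 * M ∧
          ∀ x ∈ w, x.1 = i ↔ x.2 = partnerFin hN A.1 A.2 i := by
  have hX1 : ∀ i, 1 ≤ bX i := fun i => le_trans (by omega) (hX i)
  have hY1 : ∀ i, 1 ≤ bY i := fun i => le_trans (by omega) (hY i)
  obtain ⟨w, hw, hwl⟩ := exists_isAlignment cX cY hX1 hY1 n
  refine ⟨w, hw, hwl, ?_⟩
  have hlow : (l - 1) * (2 * M - 1) ≤ w.length := by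
    rw [hwl]
    have e : 2 * M - 1 + 1 = 2 * M := by omega
    exact mul_le_lcsBlocks cX cY (by omega) hX hY (by rw [e]; exact (blockStart_le_mul hX' _).trans hnM)
      (by rw [e]; exact (blockStart_le_mul hY' _).trans hnM)
  have hc₁ := length_le_card_image_mul Prod.fst
    fun i => (hw.count_fst i).trans ((cap_le _ _ _).trans (hX' i))
  have hc₂ := length_le_card_image_mul Prod.snd
    fun i => (hw.count_snd i).trans ((cap_le _ _ _).trans (hY' i))
  have hD : ∀ x ∈ w.toFinset, x.1 < N ∧ x.2 < N := by
    intro x hx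
    have hx := List.mem_toFinset.1 hx
    constructor
    · by_contra! hcon
      have h1 := hw.count_fst x.1
      rw [cap_eq_zero ((hn.trans (mul_le_blockStart hX N)).trans (blockStart_mono _ hcon))] at h1
      exact absurd (List.count_pos_iff.2 (List.mem_map_of_mem (f := Prod.fst) hx)) (by omega)
    · by_contra! hcon
      have h1 := hw.count_snd x.2
      rw [cap_eq_zero ((hn.trans (mul_le_blockStart hY N)).trans (blockStart_mono _ hcon))] at h1
      exact absurd (List.count_pos_iff.2 (List.mem_map_of_mem (f := Prod.snd) hx)) (by omega)
  -- Each block carries at most `l + 1` symbols, so a long alignment must use all but `z` of the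
  -- first `N` blocks.
  have himg : ∀ c : ℕ, w.length ≤ c * (l + 1) → N ≤ c + z := by
    intro c hc
    have : N * (l + 1) ≤ (c + z) * (l + 1) := by rw [add_mul]; omega
    exact Nat.le_of_mul_le_mul_right this (by omega)
  obtain ⟨Γ, hΓ, hm, hcard⟩ := exists_isolated (m := 2 * M) hw.isChain
    (fun x hx => hw.parity x (List.mem_toFinset.1 hx)) hD (himg _ hc₁) (himg _ hc₂)
  obtain ⟨S, T, hS, hT, hSc, hTc, hinj, hmem⟩ := exists_partner hw.isChain hΓ hm
  have hfin : ∀ i ∈ Finset.range (2 * M) \ S, (partnerFin hN S T i : ℕ) = partner S T i := by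
    intro i hi
    have := (hm _ (hmem i hi)).2
    unfold partnerFin
    rw [dif_pos (lt_of_lt_of_le this hMN)]
  refine ⟨(S, T), ?_, ?_, ?_, fun i hi => ?_⟩
  · refine Finset.mem_filter.2 ⟨Finset.mem_product.2
      ⟨Finset.mem_powerset.2 hS, Finset.mem_powerset.2 hT⟩, fun i hi j hj h => hinj hi hj ?_⟩
    have := congrArg Fin.val h
    rwa [hfin i hi, hfin j hj] at this
  · simp only; omega
  · simp only; omega
  · have hi' := hmem i hi
    simp only
    rw [hfin i hi]
    refine ⟨List.mem_toFinset.1 (hΓ.1 hi'), (hm _ hi').2, fun x hx => ⟨fun h => ?_, fun h => ?_⟩⟩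
    · rw [hΓ.2 _ hi' x (List.mem_toFinset.2 hx) (Or.inl h.symm)]
    · rw [hΓ.2 _ hi' x (List.mem_toFinset.2 hx) (Or.inr h.symm)]

/-- The effect on the capacities of moving one symbol between two neighbouring blocks. -/
lemma cap_transfer {b b' : ℕ → ℕ} {n i : ℕ} (hsum : b' i + b' (i + 1) = b i + b (i + 1))
    (hne : ∀ j, j ≠ i → j ≠ i + 1 → b' j = b j) (hn : blockStart b (i + 2) ≤ n) :
    cap b n i = b i ∧ cap b n (i + 1) = b (i + 1) ∧ cap b' n i = b' i ∧
      cap b' n (i + 1) = b' (i + 1) ∧ ∀ j, j ≠ i → j ≠ i + 1 → cap b' n j = cap b n j := by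
  have h0 : ∀ j ≤ i, blockStart b' j = blockStart b j := fun j hj =>
    Finset.sum_congr rfl fun k hk => by
      have := Finset.mem_range.1 hk
      exact hne k (by omega) (by omega)
  have h2 : ∀ j, blockStart b' (i + 2 + j) = blockStart b (i + 2 + j) := by
    intro j
    induction j with
    | zero =>
      have e : i + 2 + 0 = i + 1 + 1 := by omega
      rw [e, blockStart_succ, blockStart_succ, blockStart_succ, blockStart_succ, h0 i le_rfl]
      omega
    | succ j ih =>
      rw [← add_assoc, blockStart_succ, blockStart_succ, ih, hne _ (by omega) (by omega)]
  have h2' : blockStart b' (i + 2) ≤ n := by rw [← add_zero (i + 2), h2 0]; exact hn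
  refine ⟨cap_eq ((blockStart_mono b (by omega)).trans hn), cap_eq hn,
    cap_eq ((blockStart_mono b' (by omega)).trans h2'), cap_eq h2', fun j h1 h3 => ?_⟩
  unfold cap
  rcases lt_or_ge j i with h | h
  · rw [h0 j h.le, h0 (j + 1) h]
  · obtain ⟨s, rfl⟩ := Nat.exists_eq_add_of_le (show i + 2 ≤ j by omega)
    rw [h2 s, add_assoc, h2 (s + 1)]

/-- Moving one symbol from block `i₂` to the neighbouring block `i₁` costs at most one. -/
lemma lcsBlocks_transfer_ge {n : ℕ} {cX cY : Bool} {bX bX' bY : ℕ → ℕ} (hX : ∀ i, 1 ≤ bX i)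
    (hX' : ∀ i, 1 ≤ bX' i) (hY : ∀ i, 1 ≤ bY i) {i₁ i₂ : ℕ}
    (h₁ : cap bX' n i₁ = cap bX n i₁ + 1) (h₂ : cap bX' n i₂ + 1 = cap bX n i₂)
    (hne : ∀ j, j ≠ i₁ → j ≠ i₂ → cap bX' n j = cap bX n j) :
    (lcsBlocks n cX cY bX bY : ℝ) - 1 ≤ lcsBlocks n cX cY bX' bY := by
  have h := lcsBlocks_le_of_cap (n := n) cX cY hX hX' hY
  have hs : ∑ i ∈ Finset.range n, (cap bX n i - cap bX' n i) ≤ 1 := by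
    calc _ ≤ ∑ i ∈ Finset.range n, if i = i₂ then 1 else 0 := by
          refine Finset.sum_le_sum fun i _ => ?_
          split_ifs with hi
          · subst hi; omega
          · by_cases hi' : i = i₁
            · subst hi'; omega
            · rw [hne i hi' hi]; omega
      _ ≤ 1 := by rw [Finset.sum_ite_eq']; split_ifs <;> omega
  have : (lcsBlocks n cX cY bX bY : ℝ) ≤ lcsBlocks n cX cY bX' bY + 1 := by
    exact_mod_cast h.trans (Nat.add_le_add_left hs _)
  linarith

section LowerBound

variable {l R N : ℕ}

/-! ### The finite model: lower bound -/

/-- Block lengths given by pairs of offsets. -/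
def pairBlocks (l : ℕ) {R : ℕ} (x : Fin R → Fin 3 × Fin 3) (i : ℕ) : ℕ :=
  l - 1 + if h : i / 2 < R then
    (if i % 2 = 0 then (x ⟨i / 2, h⟩).1 else (x ⟨i / 2, h⟩).2 : Fin 3).val else 0

/-- Block lengths given by offsets. -/
def singleBlocks (l : ℕ) {N : ℕ} (y : Fin N → Fin 3) (j : ℕ) : ℕ :=
  l - 1 + if h : j < N then (y ⟨j, h⟩).val else 0

/-- The length of the longest common subsequences as a function of the offsets. -/
noncomputable def lcsModel (n l : ℕ) {R N : ℕ} (cX cY : Bool) (x : Fin R → Fin 3 × Fin 3)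
    (y : Fin N → Fin 3) : ℝ :=
  lcsBlocks n cX cY (pairBlocks l x) (singleBlocks l y)

lemma le_pairBlocks (x : Fin R → Fin 3 × Fin 3) (i : ℕ) : l - 1 ≤ pairBlocks l x i :=
  Nat.le_add_right _ _

lemma le_singleBlocks (y : Fin N → Fin 3) (i : ℕ) : l - 1 ≤ singleBlocks l y i :=
  Nat.le_add_right _ _

lemma pairBlocks_le (hl : 1 ≤ l) (x : Fin R → Fin 3 × Fin 3) (i : ℕ) :
    pairBlocks l x i ≤ l + 1 := by
  unfold pairBlocks
  split_ifs <;> omega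

lemma singleBlocks_le (hl : 1 ≤ l) (y : Fin N → Fin 3) (i : ℕ) : singleBlocks l y i ≤ l + 1 := by
  unfold singleBlocks
  split_ifs <;> omega

lemma pairBlocks_even (x : Fin R → Fin 3 × Fin 3) (k : Fin R) :
    pairBlocks l x (2 * k) = l - 1 + (x k).1.val := by
  have h1 : 2 * (k : ℕ) / 2 = k := by omega
  simp [pairBlocks, h1]

lemma pairBlocks_odd (x : Fin R → Fin 3 × Fin 3) (k : Fin R) :
    pairBlocks l x (2 * k + 1) = l - 1 + (x k).2.val := by
  have h1 : (2 * (k : ℕ) + 1) / 2 = k := by omega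
  simp [pairBlocks, h1]

lemma pairBlocks_update_of_ne (x : Fin R → Fin 3 × Fin 3) (k : Fin R) (u : Fin 3 × Fin 3) {i : ℕ}
    (h1 : i ≠ 2 * k) (h2 : i ≠ 2 * k + 1) :
    pairBlocks l (Function.update x k u) i = pairBlocks l x i := by
  unfold pairBlocks
  by_cases h : i / 2 < R
  · rw [dif_pos h, dif_pos h, Function.update_of_ne]
    intro he
    have := congrArg Fin.val he
    simp only at this
    omega
  · rw [dif_neg h, dif_neg h]

lemma singleBlocks_apply (y : Fin N → Fin 3) (j : Fin N) : singleBlocks l y j = l - 1 + (y j).val := by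
  simp [singleBlocks]

/-- The increment of `f` at the pair `k` when the offsets `(0, 2)` or `(2, 0)` are replaced by
`(1, 1)`. -/
noncomputable def increment (f : (Fin R → Fin 3 × Fin 3) → ℝ) (k : Fin R)
    (x : Fin R → Fin 3 × Fin 3) : ℝ :=
  if x k = (0, 2) ∨ x k = (2, 0) then f (Function.update x k (1, 1)) - f x else 0

lemma gain_eq_zero {u : Fin 3 × Fin 3} (h : ¬ (u = (0, 2) ∨ u = (2, 0))) (v : Fin 3) :
    gain u v = 0 := by
  rw [not_or] at h
  rw [gain, if_neg h.1, if_neg h.2]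

/-- For every configuration there is a matching of blocks, described by a code of small size, such
that the total increment is at least its score. -/
lemma exists_code_score_le {n l M R z : ℕ} (hl : 2 ≤ l) (hM : 1 ≤ M) (hR : 0 < 2 * R) (hMR : M ≤ R)
    (hn : n ≤ 2 * R * (l - 1)) (hnM : 2 * M * (l + 1) ≤ n)
    (hz : 2 * R * (l + 1) ≤ (l - 1) * (2 * M - 1) + z * (l + 1)) (cX cY : Bool)
    (x : Fin R → Fin 3 × Fin 3) (y : Fin (2 * R) → Fin 3) :
    ∃ A ∈ codes hR M, A.1.card + A.2.card ≤ 8 * z + 8 * (R - M) ∧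
      score hR M A.1 A.2 x y - A.1.card ≤
        ∑ k ∈ Finset.univ.filter (fun k : Fin R => k.1 < M),
          increment (fun x => lcsModel n l cX cY x y) k x := by
  have hX1 : ∀ x : Fin R → Fin 3 × Fin 3, ∀ i, 1 ≤ pairBlocks l x i :=
    fun x i => le_trans (by omega) (le_pairBlocks x i)
  have hY1 : ∀ i, 1 ≤ singleBlocks l y i := fun i => le_trans (by omega) (le_singleBlocks y i)
  obtain ⟨w, hw, hwl, A, hA, hA1, hA2, hmatch⟩ := exists_code hl hM hR (by omega) hn hnM hz cX cY
    (le_pairBlocks x) (pairBlocks_le (by omega) x) (le_singleBlocks y) (singleBlocks_le (by omega) y)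
  refine ⟨A, hA, by omega, ?_⟩
  -- The first `2 * M` blocks lie entirely within the first `n` symbols, so the cut-off at `n` does
  -- not affect the transfer.
  have hcap : ∀ k : Fin R, k.1 < M → x k = (0, 2) ∨ x k = (2, 0) →
      cap (pairBlocks l x) n (2 * k) = l - 1 + (x k).1.val ∧
      cap (pairBlocks l x) n (2 * k + 1) = l - 1 + (x k).2.val ∧
      cap (pairBlocks l (Function.update x k (1, 1))) n (2 * k) = l ∧
      cap (pairBlocks l (Function.update x k (1, 1))) n (2 * k + 1) = l ∧
      ∀ j, j ≠ 2 * k.1 → j ≠ 2 * k.1 + 1 →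
        cap (pairBlocks l (Function.update x k (1, 1))) n j = cap (pairBlocks l x) n j := by
    intro k hk hu
    have h := cap_transfer (b := pairBlocks l x) (b' := pairBlocks l (Function.update x k (1, 1)))
      (n := n) (i := 2 * k) (by
        rw [pairBlocks_even, pairBlocks_odd, pairBlocks_even, pairBlocks_odd]
        rcases hu with hu | hu <;> simp [hu] <;> omega)
      (fun j h1 h2 => pairBlocks_update_of_ne x k _ h1 h2)
      ((blockStart_le_mul (pairBlocks_le (by omega) x) _).trans
        (le_trans (Nat.mul_le_mul_right _ (by omega)) hnM))
    rw [pairBlocks_even, pairBlocks_odd, pairBlocks_even, pairBlocks_odd] at h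
    have e : l - 1 + ((Function.update x k (1, 1)) k).1.val = l := by simp; omega
    have e' : l - 1 + ((Function.update x k (1, 1)) k).2.val = l := by simp; omega
    rw [e, e'] at h
    exact h
  have hcapY : ∀ j : Fin (2 * R), j.1 < 2 * M → cap (singleBlocks l y) n j = l - 1 + (y j).val := by
    intro j hj
    rw [cap_eq, singleBlocks_apply]
    exact (blockStart_le_mul (singleBlocks_le (by omega) y) _).trans
        (le_trans (Nat.mul_le_mul_right _ (by omega)) hnM)
  -- Crude bound for the pairs that meet `A.1`; there are at most `A.1.card` of them.
  have hbad : ∀ k : Fin R, k.1 < M →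
      -1 ≤ increment (fun x => lcsModel n l cX cY x y) k x := by
    intro k hk
    unfold increment
    split_ifs with hu
    · obtain ⟨h1, h2, h3, h4, h5⟩ := hcap k hk hu
      unfold lcsModel
      rcases hu with hu | hu
      · rw [hu] at h1 h2
        have := lcsBlocks_transfer_ge (n := n) (cX := cX) (cY := cY) (hX1 x)
          (hX1 (Function.update x k (1, 1))) hY1 (i₁ := 2 * k) (i₂ := 2 * k + 1)
          (by simp at h1; omega) (by simp at h2; omega) h5
        linarith
      · rw [hu] at h1 h2
        have := lcsBlocks_transfer_ge (n := n) (cX := cX) (cY := cY) (hX1 x)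
          (hX1 (Function.update x k (1, 1))) hY1 (i₁ := 2 * k + 1) (i₂ := 2 * k)
          (by simp at h2; omega) (by simp at h1; omega) fun j h h' => h5 j h' h
        linarith
    · norm_num
  have hgood : ∀ k : Fin R, k ∈ freePairs M A.1 →
      gain (x k) (y (partnerFin hR A.1 A.2 (2 * k))) +
        gain (x k).swap (y (partnerFin hR A.1 A.2 (2 * k + 1))) ≤
      increment (fun x => lcsModel n l cX cY x y) k x := by
    intro k hkf
    obtain ⟨-, hk, hk1, hk2⟩ := Finset.mem_filter.1 hkf
    unfold increment
    split_ifs with hu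
    · obtain ⟨h1, h2, h3, h4, h5⟩ := hcap k hk hu
      obtain ⟨m1, m2, m3⟩ := hmatch (2 * k) (by simp [hk1, hk])
      obtain ⟨m1', m2', m3'⟩ := hmatch (2 * k + 1) (by simp [hk2]; omega)
      have c1 := hcapY _ m2
      have c2 := hcapY _ m2'
      generalize partnerFin hR A.1 A.2 (2 * k) = j at *
      generalize partnerFin hR A.1 A.2 (2 * k + 1) = j' at *
      unfold lcsModel
      rcases hu with hu | hu
      · rw [hu] at h1 h2 ⊢
        obtain ⟨w', hw', hle⟩ := hw.exists_transfer (a' := cap (pairBlocks l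
          (Function.update x k (1, 1))) n) (i₁ := 2 * k) (i₂ := 2 * k + 1) (by omega)
          (by simp at h1; omega) (by simp at h2; omega) h5 m1 m1' m3 m3'
        have hlen := hw'.length_le (hX1 _) hY1
        rw [h1, h2, c1, c2] at hle
        have hle' : (lcsBlocks n cX cY (pairBlocks l x) (singleBlocks l y) : ℝ) +
            (if l - 1 + (0 : Fin 3).val + 1 ≤ l - 1 + (y j).val then 1 else 0) -
            (if l - 1 + (2 : Fin 3).val ≤ l - 1 + (y j').val then 1 else 0) ≤
            lcsBlocks n cX cY (pairBlocks l (Function.update x k (1, 1))) (singleBlocks l y) := by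
          rw [← hwl]
          have : (w'.length : ℤ) ≤ lcsBlocks n cX cY (pairBlocks l (Function.update x k (1, 1)))
            (singleBlocks l y) := by exact_mod_cast hlen
          have := hle.trans this
          exact_mod_cast this
        have g1 : gain (0, 2) (y j) =
            if l - 1 + (0 : Fin 3).val + 1 ≤ l - 1 + (y j).val then 1 else 0 := by
          rw [gain, if_pos rfl]
          congr 1
          rw [Fin.le_def, eq_iff_iff]
          simp only [Fin.val_zero, Fin.val_one]
          omega
        have g2 : gain (Prod.swap (0, 2)) (y j') =
            - if l - 1 + (2 : Fin 3).val ≤ l - 1 + (y j').val then 1 else 0 := by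
          rw [gain, if_neg (by decide), if_pos (by decide), ← neg_zero, ← neg_ite, neg_zero]
          congr 2
          rw [Fin.ext_iff, eq_iff_iff]
          simp only [Fin.val_two]
          omega
        rw [g1, g2]
        linarith
      · rw [hu] at h1 h2 ⊢
        obtain ⟨w', hw', hle⟩ := hw.exists_transfer (a' := cap (pairBlocks l
          (Function.update x k (1, 1))) n) (i₁ := 2 * k + 1) (i₂ := 2 * k) (by omega)
          (by simp at h2; omega) (by simp at h1; omega) (fun j h h' => h5 j h' h) m1' m1 m3' m3
        have hlen := hw'.length_le (hX1 _) hY1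
        rw [h1, h2, c1, c2] at hle
        have hle' : (lcsBlocks n cX cY (pairBlocks l x) (singleBlocks l y) : ℝ) +
            (if l - 1 + (0 : Fin 3).val + 1 ≤ l - 1 + (y j').val then 1 else 0) -
            (if l - 1 + (2 : Fin 3).val ≤ l - 1 + (y j).val then 1 else 0) ≤
            lcsBlocks n cX cY (pairBlocks l (Function.update x k (1, 1))) (singleBlocks l y) := by
          rw [← hwl]
          have : (w'.length : ℤ) ≤ lcsBlocks n cX cY (pairBlocks l (Function.update x k (1, 1)))
            (singleBlocks l y) := by exact_mod_cast hlen
          have := hle.trans this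
          exact_mod_cast this
        have g1 : gain (Prod.swap (2, 0)) (y j') =
            if l - 1 + (0 : Fin 3).val + 1 ≤ l - 1 + (y j').val then 1 else 0 := by
          rw [gain, if_pos (by decide)]
          congr 1
          rw [Fin.le_def, eq_iff_iff]
          simp only [Fin.val_zero, Fin.val_one]
          omega
        have g2 : gain (2, 0) (y j) =
            - if l - 1 + (2 : Fin 3).val ≤ l - 1 + (y j).val then 1 else 0 := by
          rw [gain, if_neg (by decide), if_pos (by decide), ← neg_zero, ← neg_ite, neg_zero]
          congr 2
          rw [Fin.ext_iff, eq_iff_iff]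
          simp only [Fin.val_two]
          omega
        rw [g1, g2]
        linarith
    · rw [gain_eq_zero hu, gain_eq_zero, add_zero]
      contrapose! hu
      rcases hu with hu | hu
      · right; rw [← Prod.swap_swap (x k), hu]; rfl
      · left; rw [← Prod.swap_swap (x k), hu]; rfl
  have hsub : freePairs M A.1 ⊆ Finset.univ.filter fun k : Fin R => k.1 < M := by
    intro k hk
    exact Finset.mem_filter.2 ⟨Finset.mem_univ _, (Finset.mem_filter.1 hk).2.1⟩
  rw [← Finset.sum_sdiff hsub]
  have hcardM : (Finset.univ.filter fun k : Fin R => k.1 < M).card ≤ M := by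
    rw [← Finset.card_range M]
    refine Finset.card_le_card_of_injOn Fin.val (fun k hk => ?_) fun _ _ _ _ h => Fin.ext h
    simpa using hk
  have hcard := le_card_freePairs (N' := R) hMR A.1
  have hcard' := Finset.card_sdiff_add_card_eq_card hsub
  have s1 : -(A.1.card : ℝ) ≤ ∑ k ∈ (Finset.univ.filter fun k : Fin R => k.1 < M) \ freePairs M A.1,
      increment (fun x => lcsModel n l cX cY x y) k x := by
    have h1 := Finset.card_nsmul_le_sum
      ((Finset.univ.filter fun k : Fin R => k.1 < M) \ freePairs M A.1)
      (fun k => increment (fun x => lcsModel n l cX cY x y) k x) (-1) fun k hk =>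
        hbad k (Finset.mem_filter.1 (Finset.mem_sdiff.1 hk).1).2
    refine le_trans ?_ h1
    rw [nsmul_eq_mul, mul_neg, mul_one, neg_le_neg_iff]
    exact_mod_cast (show _ ≤ A.1.card by omega)
  have s2 := Finset.sum_le_sum hgood
  unfold score
  linarith

/-! ### Covariance with a test statistic. -/

/-- The test statistic of one pair of blocks. -/
noncomputable def stat (u : Fin 3 × Fin 3) : ℝ :=
  2 * (if u = (1, 1) then 1 else 0) - (if u = (0, 2) then 1 else 0) - if u = (2, 0) then 1 else 0

lemma abs_stat_sub_le (u v : Fin 3 × Fin 3) : |stat u - stat v| ≤ 3 := by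
  have h : ∀ u, -1 ≤ stat u ∧ stat u ≤ 2 := by
    intro u
    unfold stat
    by_cases h1 : u = (1, 1)
    · subst h1; norm_num
    · by_cases h2 : u = (0, 2)
      · subst h2; rw [if_neg h1, if_pos rfl, if_neg (by decide)]; norm_num
      · by_cases h3 : u = (2, 0)
        · subst h3; rw [if_neg h1, if_neg h2, if_pos rfl]; norm_num
        · simp [h1, h2, h3]
  have h1 := h u
  have h2 := h v
  rw [abs_le]
  constructor <;> linarith

/-- All values of `x k` are equally likely, so by `avg_update` the part of the average on `x k = (1,
1)` can be carried to `(0, 2)` and to `(2, 0)`. It is used once for each, hence the coefficient 2 in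
`stat`. -/
lemma avg_mul_stat (f : (Fin R → Fin 3 × Fin 3) → ℝ) (k : Fin R) :
    avg (fun x => f x * stat (x k)) = avg (increment f k) := by
  have e1 : ∀ x : Fin R → Fin 3 × Fin 3, f x * stat (x k) = 2 * (if x k = (1, 1) then f x else 0) -
      (if x k = (0, 2) then f x else 0) - if x k = (2, 0) then f x else 0 := by
    intro x
    unfold stat
    split_ifs <;> ring
  have e2 : increment f k = fun x => (if x k = (0, 2) then f (Function.update x k (1, 1)) else 0) +
      (if x k = (2, 0) then f (Function.update x k (1, 1)) else 0) -
      (if x k = (0, 2) then f x else 0) - if x k = (2, 0) then f x else 0 := by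
    ext x
    unfold increment
    by_cases h1 : x k = (0, 2)
    · have h2 : ¬ x k = (2, 0) := by rw [h1]; decide
      simp [h1]
    · by_cases h2 : x k = (2, 0)
      · simp [h2]
      · simp [h1, h2]
  simp only [e1]
  rw [e2, avg_sub, avg_sub, avg_sub, avg_sub, avg_add, avg_mul_left, ← avg_update f k (1, 1) (0, 2),
    ← avg_update f k (1, 1) (2, 0)]
  ring

lemma uvar_nonneg {α : Type*} [Fintype α] [Nonempty α] (f : α → ℝ) : 0 ≤ uvar f := by
  rw [← uvar_sub_const f (avg f), uvar, avg_sub, avg_const, sub_self]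
  have := avg_nonneg fun x => sq_nonneg (f x - avg f)
  linarith

/-- The average on the left is the covariance of `f` with the sum of `stat` over `K`. That sum has
mean zero, since constants have no increment, and variance at most $9R$ by Efron–Stein. -/
lemma sq_avg_increment_le (f : (Fin R → Fin 3 × Fin 3) → ℝ) (K : Finset (Fin R)) :
    avg (fun x => ∑ k ∈ K, increment f k x) ^ 2 ≤ uvar f * (9 * R) := by
  set S : (Fin R → Fin 3 × Fin 3) → ℝ := fun x => ∑ k ∈ K, stat (x k) with hS
  have h1 : ∀ f : (Fin R → Fin 3 × Fin 3) → ℝ, avg (fun x => f x * S x) =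
      avg fun x => ∑ k ∈ K, increment f k x := by
    intro f
    simp only [hS, Finset.mul_sum, avg_sum, avg_mul_stat]
  have h0 : avg S = 0 := by
    have := h1 fun _ => 1
    simp only [one_mul] at this
    rw [show S = fun x => S x from rfl, this, avg_sum]
    exact Finset.sum_eq_zero fun k _ => by simp [increment, avg]
  have h2 : uvar S ≤ R * 3 ^ 2 := by
    refine uvar_pi_le R S fun x i v => ?_
    rw [hS]
    simp only
    rw [← Finset.sum_sub_distrib]
    calc |∑ k ∈ K, (stat (Function.update x i v k) - stat (x k))|
        = |∑ k ∈ K, if k = i then stat v - stat (x i) else 0| := by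
          congr 1
          refine Finset.sum_congr rfl fun k _ => ?_
          by_cases h : k = i
          · subst h; simp
          · simp [h]
      _ ≤ 3 := by
          rw [Finset.sum_ite_eq']
          split_ifs
          · exact abs_stat_sub_le _ _
          · simp
  have h3 := sq_avg_mul_le f S h0
  rw [h1] at h3
  refine h3.trans (mul_le_mul_of_nonneg_left ?_ (uvar_nonneg f))
  rw [uvar, h0] at h2
  linarith

lemma increment_avg {β : Type*} [Fintype β] (F : (Fin R → Fin 3 × Fin 3) → β → ℝ) (k : Fin R)
    (x : Fin R → Fin 3 × Fin 3) :
    increment (fun x => avg (F x)) k x = avg fun y => increment (fun x => F x y) k x := by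
  unfold increment
  split_ifs
  · rw [avg_sub]
  · simp [avg]

/-- The lower bound of the variance in the finite model. -/
lemma le_uvar_lcsModel {n l M R z : ℕ} (hl : 2 ≤ l) (hM : 1 ≤ M) (hR : 0 < 2 * R) (hMR : M ≤ R)
    (hn : n ≤ 2 * R * (l - 1)) (hnM : 2 * M * (l + 1) ≤ n)
    (hz : 2 * R * (l + 1) ≤ (l - 1) * (2 * M - 1) + z * (l + 1))
    (hsmall : 11 * 162 * (8 * z + 8 * (R - M)) ≤ M) (cX cY : Bool) :
    ((M : ℝ) / 162) ^ 2 ≤ uvar (fun xy : (Fin R → Fin 3 × Fin 3) × (Fin (2 * R) → Fin 3) =>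
      lcsModel n l cX cY xy.1 xy.2) * (9 * R) := by
  choose A hA hcard hscore using
    exists_code_score_le hl hM hR hMR hn hnM hz cX cY
  set K := Finset.univ.filter fun k : Fin R => k.1 < M
  set f : (Fin R → Fin 3 × Fin 3) → ℝ := fun x => avg fun y => lcsModel n l cX cY x y with hf
  have h1 := le_avg_score hR hMR A hA
  -- The code is charged 10 per element in `le_avg_score` and at most 1 more for the pairs that meet
  -- it. The factor $11\cdot162$ in `hsmall` keeps the total below half of $M/81$.
  have hpt : ∀ x y, score hR M (A x y).1 (A x y).2 x y +
      10 * (((A x y).1.card + (A x y).2.card : ℕ) : ℝ) - (M : ℝ) / 162 ≤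
      ∑ k ∈ K, increment (fun x => lcsModel n l cX cY x y) k x := by
    intro x y
    have h2 := hscore x y
    have h3 : 11 * 162 * ((A x y).1.card + (A x y).2.card) ≤ M :=
      (Nat.mul_le_mul_left _ (hcard x y)).trans hsmall
    have h4 : (11 * 162 * ((A x y).1.card + (A x y).2.card) : ℝ) ≤ M := by exact_mod_cast h3
    have h5 : (0 : ℝ) ≤ (A x y).2.card := Nat.cast_nonneg _
    push_cast
    linarith
  have h2 := avg_mono fun x => avg_mono fun y => hpt x y
  simp only [avg_sub, avg_const] at h2
  have h3 : (M : ℝ) / 162 ≤ avg fun x => ∑ k ∈ K, increment f k x := by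
    have e : ∀ x, ∑ k ∈ K, increment f k x =
        avg fun y : Fin (2 * R) → Fin 3 =>
          ∑ k ∈ K, increment (fun x => lcsModel n l cX cY x y) k x := by
      intro x
      rw [avg_sum]
      exact Finset.sum_congr rfl fun k _ => increment_avg _ k x
    simp only [e]
    linarith
  have h4 := sq_avg_increment_le f K
  -- Averaging over `y` can only decrease the variance.
  have h5 : uvar f ≤ uvar (fun xy : (Fin R → Fin 3 × Fin 3) × (Fin (2 * R) → Fin 3) =>
      lcsModel n l cX cY xy.1 xy.2) := by
    rw [uvar_prod]
    have := avg_nonneg fun x : Fin R → Fin 3 × Fin 3 =>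
      uvar_nonneg fun y : Fin (2 * R) → Fin 3 => lcsModel n l cX cY x y
    simp only
    linarith
  calc ((M : ℝ) / 162) ^ 2 ≤ (avg fun x => ∑ k ∈ K, increment f k x) ^ 2 := by gcongr
    _ ≤ uvar f * (9 * R) := h4
    _ ≤ _ := by gcongr

end LowerBound

section UpperBound

variable {l R N : ℕ}

/-! ### The finite model: upper bound -/

lemma singleBlocks_update (y : Fin N → Fin 3) (j : Fin N) (v : Fin 3) :
    singleBlocks l (Function.update y j v) =
      Function.update (singleBlocks l y) j (l - 1 + v.val) := by
  ext i
  by_cases h : i = j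
  · subst h; rw [singleBlocks_apply]; simp
  · rw [Function.update_of_ne h]
    unfold singleBlocks
    by_cases hi : i < N
    · rw [dif_pos hi, dif_pos hi, Function.update_of_ne]
      exact fun he => h (congrArg Fin.val he)
    · rw [dif_neg hi, dif_neg hi]

lemma pairBlocks_update (x : Fin R → Fin 3 × Fin 3) (k : Fin R) (u : Fin 3 × Fin 3) :
    pairBlocks l (Function.update x k u) = Function.update
      (Function.update (pairBlocks l x) (2 * k) (l - 1 + u.1.val)) (2 * k + 1) (l - 1 + u.2.val) := by
  ext i
  by_cases h : i = 2 * k + 1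
  · subst h; rw [pairBlocks_odd]; simp
  · rw [Function.update_of_ne h]
    by_cases h' : i = 2 * k
    · subst h'; rw [pairBlocks_even]; simp
    · rw [Function.update_of_ne h', pairBlocks_update_of_ne x k u h' h]

lemma pairBlocks_pos (hl : 2 ≤ l) (x : Fin R → Fin 3 × Fin 3) (i : ℕ) : 1 ≤ pairBlocks l x i :=
  le_trans (by omega) (le_pairBlocks x i)

lemma singleBlocks_pos (hl : 2 ≤ l) (y : Fin N → Fin 3) (i : ℕ) : 1 ≤ singleBlocks l y i :=
  le_trans (by omega) (le_singleBlocks y i)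

lemma abs_lcsModel_update_right_le {n : ℕ} (hl : 2 ≤ l) (cX cY : Bool) (x : Fin R → Fin 3 × Fin 3)
    (y : Fin N → Fin 3) (j : Fin N) (v : Fin 3) :
    |lcsModel n l cX cY x (Function.update y j v) - lcsModel n l cX cY x y| ≤ 2 := by
  unfold lcsModel
  rw [singleBlocks_update, lcsBlocks_comm, lcsBlocks_comm n cX]
  have h1 := le_singleBlocks (l := l) y j
  have h2 := singleBlocks_le (l := l) (by omega) y j
  exact_mod_cast abs_lcsBlocks_update_sub_le (n := n) (d := 2) cY cX (singleBlocks_pos hl y)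
    (pairBlocks_pos hl x) (i := j) (v := l - 1 + v.val) (by omega) (by omega) (by omega)

lemma abs_lcsModel_update_left_le {n : ℕ} (hl : 2 ≤ l) (cX cY : Bool) (x : Fin R → Fin 3 × Fin 3)
    (y : Fin N → Fin 3) (k : Fin R) (u : Fin 3 × Fin 3) :
    |lcsModel n l cX cY (Function.update x k u) y - lcsModel n l cX cY x y| ≤ 4 := by
  unfold lcsModel
  rw [pairBlocks_update]
  have h1 := le_pairBlocks (l := l) x (2 * k)
  have h2 := pairBlocks_le (l := l) (by omega) x (2 * k)
  have h1' := le_pairBlocks (l := l) x (2 * k + 1)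
  have h2' := pairBlocks_le (l := l) (by omega) x (2 * k + 1)
  have e : Function.update (pairBlocks l x) (2 * k) (l - 1 + u.1.val) (2 * k.1 + 1) =
    pairBlocks l x (2 * k + 1) := Function.update_of_ne (by omega) _ _
  have s1 := abs_lcsBlocks_update_sub_le (n := n) (d := 2) cX cY (pairBlocks_pos hl x)
    (singleBlocks_pos hl y) (i := 2 * k) (v := l - 1 + u.1.val) (by omega) (by omega) (by omega)
  have s2 := abs_lcsBlocks_update_sub_le (n := n) (d := 2) cX cY
    (update_pos (pairBlocks_pos hl x) (i := 2 * k) (v := l - 1 + u.1.val) (by omega))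
    (singleBlocks_pos hl y) (i := 2 * k + 1) (v := l - 1 + u.2.val) (by omega)
    (by rw [e]; omega) (by rw [e]; omega)
  rw [abs_le] at s1 s2 ⊢
  push_cast at s1 s2
  constructor <;> linarith

lemma lcsBlocks_congr_colour {n : ℕ} {cX cY cX' cY' : Bool} (h : cX = cY ↔ cX' = cY')
    {bX bY : ℕ → ℕ} (hX : ∀ i, 1 ≤ bX i) (hY : ∀ i, 1 ≤ bY i) :
    lcsBlocks n cX cY bX bY = lcsBlocks n cX' cY' bX bY := by
  refine le_antisymm ?_ ?_
  · obtain ⟨w, hw, hl⟩ := exists_isAlignment cX cY hX hY n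
    rw [propext h] at hw
    unfold lcsBlocks
    rw [← hl]
    exact hw.length_le hX hY
  · obtain ⟨w, hw, hl⟩ := exists_isAlignment cX' cY' hX hY n
    rw [← propext h] at hw
    unfold lcsBlocks
    rw [← hl]
    exact hw.length_le hX hY

/-- Only whether the first symbols agree matters. If this changes, rotate the offsets of $Y$
cyclically: the uniform law is preserved, and the deletion of the first block costs at most $l+1$.
-/
lemma avg_lcsModel_le {n : ℕ} (hl : 2 ≤ l) (hn : n ≤ N * (l - 1)) (hN : 0 < N)
    (x : Fin R → Fin 3 × Fin 3) (cX cY cX' cY' : Bool) :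
    avg (fun y : Fin N → Fin 3 => lcsModel n l cX cY x y) ≤
      avg (fun y : Fin N → Fin 3 => lcsModel n l cX' cY' x y) + (l + 1) := by
  by_cases h : cX = cY ↔ cX' = cY'
  · have : ∀ y : Fin N → Fin 3, lcsModel n l cX cY x y = lcsModel n l cX' cY' x y := by
      intro y
      unfold lcsModel
      rw [lcsBlocks_congr_colour h (pairBlocks_pos hl x) (singleBlocks_pos hl y)]
    simp only [this]
    have : (0 : ℝ) ≤ l := Nat.cast_nonneg l
    linarith
  · obtain ⟨K, rfl⟩ := Nat.exists_eq_succ_of_ne_zero hN.ne'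
    rw [← avg_comp_equiv (Equiv.arrowCongr (finRotate (K + 1)).symm (Equiv.refl (Fin 3)))
      (fun y : Fin (K + 1) → Fin 3 => lcsModel n l cX' cY' x y), ← avg_const (α := Fin (K + 1) → Fin 3)
      ((l : ℝ) + 1), ← avg_add]
    refine avg_mono fun y => ?_
    have hp : (cX = !cY) ↔ cX' = cY' := by
      revert h; cases cX <;> cases cY <;> cases cX' <;> cases cY' <;> simp
    unfold lcsModel
    set y' := Equiv.arrowCongr (finRotate (K + 1)).symm (Equiv.refl (Fin 3)) y with hy'
    have hs : ∀ j < K, singleBlocks l y' j = singleBlocks l y (j + 1) := by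
      intro j hj
      unfold singleBlocks
      rw [dif_pos (show j < K + 1 by omega), dif_pos (show j + 1 < K + 1 by omega), hy']
      simp [Equiv.arrowCongr, finRotate_of_lt hj]
    have h1 := lcsBlocks_le_shift (n := n) cX cY (pairBlocks_pos hl x) (singleBlocks_pos hl y)
      (singleBlocks_pos hl y') (hn.trans (mul_le_blockStart (le_singleBlocks y) _)) hs
    rw [lcsBlocks_congr_colour hp (pairBlocks_pos hl x) (singleBlocks_pos hl y')] at h1
    have h2 := singleBlocks_le (l := l) (by omega) y 0
    exact_mod_cast h1.trans (Nat.add_le_add_left h2 _)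

/-- The length of the longest common subsequences as a function of the first symbols and of the
offsets. -/
noncomputable def lcsTotal (n l R N : ℕ)
    (t : (Bool × Bool) × ((Fin R → Fin 3 × Fin 3) × (Fin N → Fin 3))) : ℝ :=
  lcsModel n l t.1.1 t.1.2 t.2.1 t.2.2

/-- The upper bound of the variance in the finite model. -/
lemma uvar_lcsTotal_le {n : ℕ} (hl : 2 ≤ l) (hn : n ≤ N * (l - 1)) (hN : 0 < N) :
    uvar (lcsTotal n l R N) ≤ N * 2 ^ 2 + R * 4 ^ 2 + (l + 1) ^ 2 := by
  refine uvar_prod_le (fun c => uvar_prod_le (fun x => ?_) ?_) ?_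
  · exact uvar_pi_le N _ fun y j v => abs_lcsModel_update_right_le hl c.1 c.2 x y j v
  · exact uvar_pi_le R _ fun x k u => abs_avg_sub_le fun y =>
      abs_lcsModel_update_left_le hl c.1 c.2 x y k u
  · refine uvar_le_of_osc fun c c' => ?_
    simp only [lcsTotal]
    rw [avg_prod, avg_prod]
    refine abs_avg_sub_le fun x => ?_
    have h1 := avg_lcsModel_le hl hn hN x c.1 c.2 c'.1 c'.2
    have h2 := avg_lcsModel_le hl hn hN x c'.1 c'.2 c.1 c.2
    rw [abs_le]
    constructor <;> linarith

lemma le_uvar_lcsTotal {n : ℕ} {v : ℝ}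
    (h : ∀ cX cY, v ≤ uvar (fun xy : (Fin R → Fin 3 × Fin 3) × (Fin N → Fin 3) =>
      lcsModel n l cX cY xy.1 xy.2)) : v ≤ uvar (lcsTotal n l R N) := by
  rw [uvar_prod]
  have h1 := avg_mono fun c : Bool × Bool => h c.1 c.2
  rw [avg_const] at h1
  have h2 := uvar_nonneg fun c : Bool × Bool => avg fun xy => lcsTotal n l R N (c, xy)
  simp only [lcsTotal] at h2 ⊢
  linarith

end UpperBound

/-! ### Transfer to the finite model -/

/-- The offset of a block length. -/
def offset (l b : ℕ) : Fin 3 := if b + 1 = l then 0 else if b = l then 1 else 2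

section Transfer

variable {Ω : Type*} [MeasurableSpace Ω] {μ : Measure Ω} {l : ℕ}

/-- The configuration of the finite model. -/
def config (l R N : ℕ) (cX : Ω → Bool) (BX : ℕ → Ω → ℕ) (cY : Ω → Bool) (BY : ℕ → Ω → ℕ) (ω : Ω) :
    (Bool × Bool) × ((Fin R → Fin 3 × Fin 3) × (Fin N → Fin 3)) :=
  ((cX ω, cY ω), (fun k => (offset l (BX (2 * k) ω), offset l (BX (2 * k + 1) ω)),
    fun j => offset l (BY j ω)))

variable {cX : Ω → Bool} {BX : ℕ → Ω → ℕ} {cY : Ω → Bool} {BY : ℕ → Ω → ℕ}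

lemma IsBlockModel.measurable_config (h : IsBlockModel μ l cX BX cY BY) (R N : ℕ) :
    Measurable (config l R N cX BX cY BY) := by
  have hX : ∀ i, Measurable fun ω => offset l (BX i ω) := fun i =>
    (Measurable.of_discrete (f := offset l)).comp (h.left.measurable_length i)
  have hY : ∀ i, Measurable fun ω => offset l (BY i ω) := fun i =>
    (Measurable.of_discrete (f := offset l)).comp (h.right.measurable_length i)
  exact (h.left.measurable_symbol.prodMk h.right.measurable_symbol).prodMk
    ((measurable_pi_lambda _ fun k => (hX _).prodMk (hX _)).prodMk
      (measurable_pi_lambda _ fun j => hY _))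

variable [IsProbabilityMeasure μ]

lemma IsBlockData.ae_length {c : Ω → Bool} {B : ℕ → Ω → ℕ} (h : IsBlockData μ l c B) :
    ∀ᵐ ω ∂μ, ∀ i, B i ω + 1 = l ∨ B i ω = l ∨ B i ω = l + 1 := by
  rw [ae_all_iff]
  intro i
  have hm : ∀ p : ℕ → Prop, MeasurableSet {ω | p (B i ω)} := fun p =>
    h.measurable_length i (MeasurableSet.of_discrete (s := {b | p b}))
  have e : {ω | B i ω + 1 = l ∨ B i ω = l ∨ B i ω = l + 1} =
      {ω | B i ω + 1 = l} ∪ ({ω | B i ω = l} ∪ {ω | B i ω = l + 1}) := by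
    ext ω; rfl
  have : {ω | B i ω + 1 = l ∨ B i ω = l ∨ B i ω = l + 1} ∈ ae μ := by
    rw [mem_ae_iff_prob_eq_one (hm fun b => b + 1 = l ∨ b = l ∨ b = l + 1), e,
      measure_union _ ((hm fun b => b = l).union (hm fun b => b = l + 1)),
      measure_union _ (hm fun b => b = l + 1), h.length_law_pred, h.length_law_self,
      h.length_law_succ, ← ENNReal.toReal_eq_one_iff, ENNReal.toReal_add (by simp) (by simp),
      ENNReal.toReal_add (by simp) (by simp)]
    · norm_num
    · rw [Set.disjoint_left]
      intro ω h1 h2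
      have h1 : B i ω = l := h1
      have h2 : B i ω = l + 1 := h2
      omega
    · rw [Set.disjoint_left]
      intro ω h1 h2
      have h1 : B i ω + 1 = l := h1
      have h2 : B i ω = l ∨ B i ω = l + 1 := h2
      omega
  exact this

/-- Almost surely the block length is one of the three admissible values, so the default value 2 of
`offset` does no harm. -/
lemma IsBlockData.measure_offset {c : Ω → Bool} {B : ℕ → Ω → ℕ} (h : IsBlockData μ l c B) (i : ℕ)
    (v : Fin 3) : μ (B i ⁻¹' {b | offset l b = v}) = 1 / 3 := by
  have hae := h.ae_length
  have key : ∀ p : ℕ → Prop, (∀ b, (b + 1 = l ∨ b = l ∨ b = l + 1) → (offset l b = v ↔ p b)) →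
      μ (B i ⁻¹' {b | offset l b = v}) = μ {ω | p (B i ω)} := by
    intro p hp
    refine measure_congr ?_
    filter_upwards [hae] with ω hω
    exact propext (hp _ (hω i))
  fin_cases v
  · rw [key (fun b => b + 1 = l), h.length_law_pred]
    intro b hb
    unfold offset
    split_ifs <;> simp <;> omega
  · rw [key (fun b => b = l), h.length_law_self]
    intro b hb
    unfold offset
    split_ifs <;> simp <;> omega
  · rw [key (fun b => b = l + 1), h.length_law_succ]
    intro b hb
    unfold offset
    split_ifs <;> simp <;> omega

lemma measurableSet_offset (l N : ℕ) (v : ℕ → Fin 3) :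
    MeasurableSet {g : ℕ → ℕ | ∀ i < N, offset l (g i) = v i} := by
  have : {g : ℕ → ℕ | ∀ i < N, offset l (g i) = v i} =
      ⋂ i, ⋂ _ : i < N, (fun g : ℕ → ℕ => g i) ⁻¹' {b | offset l b = v i} := by
    ext g; simp
  rw [this]
  exact MeasurableSet.iInter fun i => MeasurableSet.iInter fun _ =>
    measurable_pi_apply i MeasurableSet.of_discrete

lemma IsBlockData.measure_cylinder {c : Ω → Bool} {B : ℕ → Ω → ℕ} (h : IsBlockData μ l c B)
    (s : Bool) (N : ℕ) (v : ℕ → Fin 3) :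
    μ {ω | c ω = s ∧ ∀ i < N, offset l (B i ω) = v i} = 1 / 2 * (1 / 3) ^ N := by
  have h1 := h.indep_symbol_length.measure_inter_preimage_eq_mul {s}
    {g : ℕ → ℕ | ∀ i < N, offset l (g i) = v i} (measurableSet_singleton s)
    (measurableSet_offset l N v)
  have h2 := h.indep_length.measure_inter_preimage_eq_mul (Finset.range N)
    (sets := fun i => {b | offset l b = v i}) fun i _ => MeasurableSet.of_discrete
  have e : (fun ω i => B i ω) ⁻¹' {g : ℕ → ℕ | ∀ i < N, offset l (g i) = v i} =
      ⋂ i ∈ Finset.range N, B i ⁻¹' {b | offset l b = v i} := by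
    ext ω; simp
  simp only [h.measure_offset] at h2
  rw [Finset.prod_const, Finset.card_range] at h2
  rw [e, h2] at h1
  have e' : {ω | c ω = s ∧ ∀ i < N, offset l (B i ω) = v i} =
      c ⁻¹' {s} ∩ ⋂ i ∈ Finset.range N, B i ⁻¹' {b | offset l b = v i} := by
    rw [← e]; rfl
  rw [e', h1, ← h.symbol_law s]
  rfl

lemma IsBlockModel.measure_config (h : IsBlockModel μ l cX BX cY BY) (R N : ℕ)
    (t : (Bool × Bool) × ((Fin R → Fin 3 × Fin 3) × (Fin N → Fin 3))) :
    (μ.map (config l R N cX BX cY BY)).real {t} =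
      1 / Fintype.card ((Bool × Bool) × ((Fin R → Fin 3 × Fin 3) × (Fin N → Fin 3))) := by
  obtain ⟨⟨s, s'⟩, x, y⟩ := t
  rw [measureReal_def, Measure.map_apply (h.measurable_config R N) (measurableSet_singleton _)]
  set u : ℕ → Fin 3 := fun i => if hi : i / 2 < R then
    (if i % 2 = 0 then (x ⟨i / 2, hi⟩).1 else (x ⟨i / 2, hi⟩).2) else 0 with hu
  set v : ℕ → Fin 3 := fun j => if hj : j < N then y ⟨j, hj⟩ else 0 with hv
  have hm : ∀ (s : Bool) (N : ℕ) (v : ℕ → Fin 3),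
      MeasurableSet {p : Bool × (ℕ → ℕ) | p.1 = s ∧ ∀ i < N, offset l (p.2 i) = v i} :=
    fun s N v => (measurable_fst (measurableSet_singleton s)).inter
      (measurable_snd (measurableSet_offset l N v))
  have h1 := h.indep.measure_inter_preimage_eq_mul
    {p : Bool × (ℕ → ℕ) | p.1 = s ∧ ∀ i < 2 * R, offset l (p.2 i) = u i}
    {p : Bool × (ℕ → ℕ) | p.1 = s' ∧ ∀ i < N, offset l (p.2 i) = v i} (hm _ _ _) (hm _ _ _)
  have e : config l R N cX BX cY BY ⁻¹' {((s, s'), x, y)} =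
      (fun ω => (cX ω, fun i => BX i ω)) ⁻¹'
        {p : Bool × (ℕ → ℕ) | p.1 = s ∧ ∀ i < 2 * R, offset l (p.2 i) = u i} ∩
      (fun ω => (cY ω, fun i => BY i ω)) ⁻¹'
        {p : Bool × (ℕ → ℕ) | p.1 = s' ∧ ∀ i < N, offset l (p.2 i) = v i} := by
    ext ω
    simp only [config, Set.mem_preimage, Set.mem_singleton_iff, Set.mem_inter_iff,
      Set.mem_ofPred_eq, Prod.mk.injEq, funext_iff]
    have eX : (∀ k : Fin R, (offset l (BX (2 * k) ω), offset l (BX (2 * k + 1) ω)) = x k) ↔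
        ∀ i < 2 * R, offset l (BX i ω) = u i := by
      constructor
      · intro hk i hi
        have hi' : i / 2 < R := by omega
        have := hk ⟨i / 2, hi'⟩
        rw [hu]
        simp only [dif_pos hi', ← this]
        split_ifs with h2
        · congr 2; omega
        · congr 2; omega
      · intro hi k
        have h1 := hi (2 * k) (by omega)
        have h2 := hi (2 * k + 1) (by omega)
        have e1 : 2 * (k : ℕ) / 2 = k := by omega
        have e2 : (2 * (k : ℕ) + 1) / 2 = k := by omega
        rw [h1, h2, hu]
        simp [e1, e2]
    have eY : (∀ j : Fin N, offset l (BY j ω) = y j) ↔ ∀ i < N, offset l (BY i ω) = v i := by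
      constructor
      · intro hj i hi
        rw [hv]
        simp only [dif_pos hi]
        exact hj ⟨i, hi⟩
      · intro hi j
        rw [hi j j.2, hv]
        simp
    rw [← eX, ← eY]
    tauto
  rw [e, h1]
  have c1 := h.left.measure_cylinder s (2 * R) u
  have c2 := h.right.measure_cylinder s' N v
  change (μ {ω | cX ω = s ∧ ∀ i < 2 * R, offset l (BX i ω) = u i} *
    μ {ω | cY ω = s' ∧ ∀ i < N, offset l (BY i ω) = v i}).toReal = _
  rw [c1, c2]
  simp only [ENNReal.toReal_mul, ENNReal.toReal_pow, ENNReal.toReal_div, ENNReal.toReal_one,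
    ENNReal.toReal_ofNat, Fintype.card_prod, Fintype.card_bool, Fintype.card_pi, Fintype.card_fin,
    Finset.prod_const, Finset.card_univ]
  push_cast
  rw [pow_mul]
  simp only [div_pow, one_pow]
  field_simp
  norm_num

lemma blockString_congr {b b' : ℕ → ℕ} (hb : ∀ i, 1 ≤ b i) (hb' : ∀ i, 1 ≤ b' i) {n N : ℕ}
    (h : ∀ i < N, b i = b' i) (hn : n ≤ blockStart b N) (c : Bool) :
    blockString c b n = blockString c b' n := by
  rw [blockString_eq, blockString_eq]
  congr 1
  refine List.map_congr_left fun t ht => ?_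
  have ht := List.mem_range.1 ht
  have hs := blockIndex_spec hb t
  have hk : blockIndex b t < N := by
    by_contra! hcon
    have := blockStart_mono b hcon
    omega
  have hst : ∀ k ≤ N, blockStart b k = blockStart b' k := fun k hk =>
    Finset.sum_congr rfl fun i hi => h i (lt_of_lt_of_le (Finset.mem_range.1 hi) hk)
  rw [hst _ hk.le, hst _ hk] at hs
  exact ((blockIndex_eq_iff hb' t _).2 hs).symm

lemma offset_eq {l b : ℕ} (hl : 1 ≤ l) (h : b + 1 = l ∨ b = l ∨ b = l + 1) :
    l - 1 + (offset l b).val = b := by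
  unfold offset
  split_ifs <;> simp <;> omega

/-- The variance of the length of the longest common subsequences is that of the finite model. -/
lemma IsBlockModel.variance_eq (h : IsBlockModel μ l cX BX cY BY) (hl : 2 ≤ l) {n R N : ℕ}
    (hR : n ≤ 2 * R * (l - 1)) (hN : n ≤ N * (l - 1)) :
    variance (fun ω => (L cX BX cY BY n ω : ℝ)) μ = uvar (lcsTotal n l R N) := by
  -- Block lengths are at least `l - 1`, so the first `2 * R` and `N` blocks cover all `n` symbols;
  -- the blocks added by the finite model beyond them are irrelevant.
  have hae : (fun ω => (L cX BX cY BY n ω : ℝ)) =ᵐ[μ]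
      lcsTotal n l R N ∘ config l R N cX BX cY BY := by
    filter_upwards [h.left.ae_length, h.right.ae_length] with ω hX hY
    simp only [Function.comp, lcsTotal, lcsModel, lcsBlocks, config, L, Nat.cast_inj]
    rw [← blockString_congr (b := fun i => BX i ω) (fun i => by have := hX i; omega)
      (pairBlocks_pos hl _) (N := 2 * R) (fun i hi => ?_)
      (hR.trans (mul_le_blockStart (fun i => by have := hX i; omega) _)),
      ← blockString_congr (b := fun i => BY i ω) (fun i => by have := hY i; omega)
      (singleBlocks_pos hl _) (N := N) (fun i hi => ?_)
      (hN.trans (mul_le_blockStart (fun i => by have := hY i; omega) _))]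
    · unfold singleBlocks
      rw [dif_pos hi]
      exact (offset_eq (by omega) (hY i)).symm
    · unfold pairBlocks
      rw [dif_pos (show i / 2 < R by omega)]
      simp only
      split_ifs with h2
      · rw [show 2 * (i / 2) = i by omega]
        exact (offset_eq (by omega) (hX i)).symm
      · rw [show 2 * (i / 2) + 1 = i by omega]
        exact (offset_eq (by omega) (hX i)).symm
  have hm := h.measurable_config R N
  have : IsProbabilityMeasure (μ.map (config l R N cX BX cY BY)) :=
    Measure.isProbabilityMeasure_map hm.aemeasurable
  have hint : ∀ f : (Bool × Bool) × ((Fin R → Fin 3 × Fin 3) × (Fin N → Fin 3)) → ℝ,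
      ∫ t, f t ∂(μ.map (config l R N cX BX cY BY)) = avg f := by
    intro f
    rw [integral_fintype Integrable.of_finite]
    simp only [h.measure_config, smul_eq_mul]
    rw [← Finset.mul_sum, avg]
    ring
  rw [variance_congr hae, ← variance_map Measurable.of_discrete.aemeasurable hm.aemeasurable,
    variance_eq_sub MemLp.of_discrete, hint, hint]
  rfl

end Transfer

/-! ### Choice of the parameters and conclusion. -/

/-- The numbers of blocks that are needed satisfy the requirements of the finite model. -/
lemma block_numbers {n l M R : ℕ} (hl : 1000001 ≤ l) (hM : M = n / (2 * (l + 1)))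
    (hR : R = n / (2 * (l - 1)) + 1) (hn : 2000000 * (l + 1) ≤ n) :
    ∃ z, 1 ≤ M ∧ M ≤ R ∧ R ≤ 2 * M ∧ n ≤ 2 * R * (l - 1) ∧ 2 * M * (l + 1) ≤ n ∧
      n ≤ 4 * (l + 1) * M ∧ 2 * R * (l + 1) ≤ (l - 1) * (2 * M - 1) + z * (l + 1) ∧
      11 * 162 * (8 * z + 8 * (R - M)) ≤ M := by
  obtain ⟨d, rfl⟩ : ∃ d, l = d + 1 := ⟨l - 1, by omega⟩
  simp only [Nat.add_sub_cancel] at *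
  have hM1 : 1000000 ≤ M := by
    rw [hM, Nat.le_div_iff_mul_le (by omega)]
    linarith
  have hMn : 2 * M * (d + 1 + 1) ≤ n := by
    have := Nat.div_mul_le_self n (2 * (d + 1 + 1))
    rw [← hM] at this
    linarith
  have hMn' : n < 2 * (M + 1) * (d + 1 + 1) := by
    have := Nat.lt_div_mul_add (a := n) (b := 2 * (d + 1 + 1)) (by omega)
    rw [← hM] at this
    linarith
  have hRn : n ≤ 2 * R * d := by
    have := Nat.lt_div_mul_add (a := n) (b := 2 * d) (by omega)
    rw [hR]
    linarith
  have hRn' : 2 * (R - 1) * d ≤ n := by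
    have := Nat.div_mul_le_self n (2 * d)
    have e : R - 1 = n / (2 * d) := by rw [hR]; rfl
    rw [e]
    linarith
  have hMR : M ≤ R := by
    have : M * (2 * d) ≤ R * (2 * d) := by nlinarith
    exact Nat.le_of_mul_le_mul_right this (by omega)
  obtain ⟨e, rfl⟩ := Nat.exists_eq_add_of_le hMR
  have he : 1000000 * e ≤ 2 * M + 3000000 := by
    rcases Nat.lt_or_ge e 3 with h | h
    · omega
    · obtain ⟨f, rfl⟩ := Nat.exists_eq_add_of_le h
      have e1 : M + (3 + f) - 1 = M + 2 + f := by omega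
      rw [e1] at hRn'
      have h1 : (f + 1) * d < 2 * (M + 1) := by nlinarith
      have h2 : (f + 1) * 1000000 ≤ (f + 1) * d := Nat.mul_le_mul_left _ (by omega)
      omega
  set q := 4 * M / (d + 2) with hq
  have hq1 : q * 1000000 ≤ 4 * M := by
    have h1 := Nat.div_mul_le_self (4 * M) (d + 2)
    have h2 : q * 1000000 ≤ q * (d + 2) := Nat.mul_le_mul_left _ (by omega)
    rw [← hq] at h1
    omega
  have hq2 : 4 * M < q * (d + 2) + (d + 2) := Nat.lt_div_mul_add (by omega)
  -- With $e=R-M$, $d=l-1$, the deficit $2R(l+1)-(l-1)(2M-1)$ equals $2e(d+2)+4M+d$. Here $4M$ costs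
  -- at most $q+1$ multiples of $d+2$ and $d$ costs one.
  refine ⟨2 * e + 2 + q, by omega, hMR, by omega, hRn, hMn, ?_, ?_, ?_⟩
  · nlinarith
  · obtain ⟨m, rfl⟩ : ∃ m, M = m + 1 := ⟨M - 1, by omega⟩
    have e2 : 2 * (m + 1) - 1 = 2 * m + 1 := by omega
    rw [e2]
    nlinarith
  · omega

end BlockLCS

theorem theorem1 :
    ∃ l₀ : ℕ, ∀ l : ℕ, l₀ ≤ l →
      ∃ a b : ℝ, 0 < a ∧ a < b ∧ ∃ n₀ : ℕ, ∀ n : ℕ, n₀ ≤ n →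
        ∀ (Ω : Type*) [MeasurableSpace Ω] (μ : Measure Ω) [IsProbabilityMeasure μ]
          (cX : Ω → Bool) (BX : ℕ → Ω → ℕ) (cY : Ω → Bool) (BY : ℕ → Ω → ℕ),
          BlockLCS.IsBlockModel μ l cX BX cY BY →
            a * (n : ℝ) ≤ variance (fun ω => (BlockLCS.L cX BX cY BY n ω : ℝ)) μ ∧
            variance (fun ω => (BlockLCS.L cX BX cY BY n ω : ℝ)) μ ≤ b * (n : ℝ) := by
  -- From $R\le 2M$: $(M/162)^2/(9R)\ge M/472392$, and $n\le 4(l+1)M$ gives $4\cdot472392=1889568$.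
  -- Above, with `N = 2 * R`, the Efron–Stein terms add up to $24R\le 24n$.
  refine ⟨1000001, fun l hl => ⟨1 / (1889568 * (l + 1)), 24 + (l + 1) ^ 2, by positivity, ?_,
    2000000 * (l + 1), fun n hn Ω _ μ _ cX BX cY BY h => ?_⟩⟩
  · have h1 : (1 : ℝ) / (1889568 * (l + 1)) ≤ 1 := by
      rw [div_le_one (by positivity)]
      have : (0 : ℝ) ≤ l := Nat.cast_nonneg l
      linarith
    nlinarith [sq_nonneg ((l : ℝ) + 1)]
  · obtain ⟨z, hM, hMR, hRM, hnR, hMn, hnM, hz, hsmall⟩ :=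
      BlockLCS.block_numbers hl rfl rfl hn
    set M := n / (2 * (l + 1))
    set R := n / (2 * (l - 1)) + 1
    rw [h.variance_eq (by omega) hnR hnR]
    have hM0 : (1 : ℝ) ≤ M := by exact_mod_cast hM
    have hR2 : (R : ℝ) ≤ 2 * M := by exact_mod_cast hRM
    have hR0 : (0 : ℝ) < R := by
      have : (M : ℝ) ≤ R := by exact_mod_cast hMR
      linarith
    constructor
    · refine BlockLCS.le_uvar_lcsTotal fun cX cY => ?_
      have h1 := BlockLCS.le_uvar_lcsModel (by omega) hM (by omega) hMR hnR hMn hz hsmall cX cY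
      rw [← div_le_iff₀ (by positivity)] at h1
      refine le_trans ?_ h1
      have h2 : (n : ℝ) ≤ 4 * (l + 1) * M := by exact_mod_cast hnM
      have h3 : (1 : ℝ) / (1889568 * (l + 1)) * n ≤ M / 472392 := by
        rw [one_div_mul_eq_div, div_le_div_iff₀ (by positivity) (by norm_num)]
        linarith
      refine h3.trans ?_
      rw [le_div_iff₀ (by positivity)]
      have h4 : (M : ℝ) / 472392 * (9 * R) ≤ M / 472392 * (9 * (2 * M)) := by gcongr
      refine h4.trans (le_of_eq ?_)
      ring
    · refine (BlockLCS.uvar_lcsTotal_le (by omega) hnR (by omega)).trans ?_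
      have hRn : 24 * R ≤ 24 * n := by
        have : 2 * M * 1 ≤ 2 * M * (l + 1) := Nat.mul_le_mul_left _ (by omega)
        omega
      have hRn' : 24 * (R : ℝ) ≤ 24 * n := by exact_mod_cast hRn
      have hn1 : (1 : ℝ) ≤ n := by
        have : 1 ≤ n := by omega
        exact_mod_cast this
      have h5 : ((l : ℝ) + 1) ^ 2 ≤ (l + 1) ^ 2 * n := le_mul_of_one_le_right (by positivity) hn1
      push_cast
      linarith
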